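/- **Setting.** Let $\Omega\subset\mathbb R^d$ be a bounded open set, $\Omega=\Omega_1\cup\Omega_2$ with $\Omega_1,\Omega_2$ open, and let $\Gamma_i=\partial\Omega_i\cap\Omega$ ($i=1,2$) be the ports; write $i'=3-i$. Let $\phi_1,\phi_2:\Omega\to[0,1]$ be a Lipschitz partition of unity: $\phi_1+\phi_2=1$ in $\Omega$, and $\phi_i=0$ in $\Omega\setminus\Omega_i$. A function $v\in H^1(\Omega_i)$ has zero trace on $\Gamma_i$, $v|_{\Gamma_i}=0$, if it is a limit in $H^1(\Omega_i)$ of functions in $H^1(\Omega_i)$ each of which vanishes a.e. in $\{x\in\Omega_i:\operatorname{dist}(x,\Gamma_i)<\varepsilon\}$ for some $\varepsilon>0$. The trace $v|_{\Gamma_i}$ is the class of $v$ modulo the functions with zero trace; the space $H^{1/2}(\Gamma_i)$ of these traces carries the inner product $(\cdot,\cdot)_{H^{1/2}(\Gamma_i)}$ of the quotient norm $\|\lambda\|=\inf\{\|v\|_{H^1(\Omega_i)}: v|_{\Gamma_i}=\lambda\}$. Let $\mathcal X$ be a closed subspace of $H^1(\Omega)$ with $H^1_0(\Omega)\subset\mathcal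 X\subset H^1(\Omega)$. For $i=1,2$ put $$\mathcal X_i=\{v|_{\Omega_i}:v\in\mathcal X\},\qquad \mathcal X_{i,0}=\{v\in\mathcal X_i: v|_{\Gamma_i}=0\},\qquad \mathcal U_i=\{v|_{\Gamma_i}:v\in\mathcal X_i\},$$ and $\mathcal U=\mathcal U_1\times\mathcal U_2$ with $\langle w,v\rangle=\sum_{i=1}^2(w_i,v_i)_{H^{1/2}(\Gamma_i)}$. For $u\in\mathcal X$ write $u|_{\Gamma_i}=(u|_{\Omega_i})|_{\Gamma_i}$. For $v\in\mathcal X_{i,0}$ let $v^{\rm ext}$ be its extension by zero to $\Omega$. Assume that $\mathcal X$ is compatible with the decomposition: for $i=1,2$, the function $v^{\rm ext}$, for $v\in\mathcal X_{i,0}$, and the function $\phi_i v$, for $v\in\mathcal X$, belong to $\mathcal X$ whenever they belong to $H^1(\Omega)$. (For example, $\mathcal X$ may be a space of functions satisfying homogeneous Dirichlet conditions on a part of $\partial\Omega$.) Let $a:\mathcal X\times\mathcal X\to\mathbb R$ be bilinear, continuous and coercive for the $H^1(\Omega)$-norm, with constants $\gamma$ and $\alpha>0$, and let $f\in\mathcal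 X'$. Assume that $a$ is local: there are bilinear forms on $\mathcal X_i\times\mathcal X_{i,0}$, $i=1,2$, also denoted by $a$, with $$a(u,v^{\rm ext})=a(u|_{\Omega_i},v)\qquad\text{for all }u\in\mathcal X,\ v\in\mathcal X_{i,0}.$$ Write $f(v)=f(v^{\rm ext})$ for $v\in\mathcal X_{i,0}$. Define $T_i:\mathcal U_i\to\mathcal X_i$ and $G_if\in\mathcal X_{i,0}$ by $$(T_i\lambda)|_{\Gamma_i}=\lambda,\quad a(T_i\lambda,v)=0\quad\forall v\in\mathcal X_{i,0};\qquad (G_if)|_{\Gamma_i}=0,\quad a(G_if,v)=f(v)\quad\forall v\in\mathcal X_{i,0},$$ let $\chi_{\Gamma_i}:\mathcal X_{i'}\to\mathcal U_i$, $\chi_{\Gamma_i}(w|_{\Omega_{i'}})=w|_{\Gamma_i}$ for $w\in\mathcal X$, be the trace on $\Gamma_i$, and put $$T\lambda=(\chi_{\Gamma_1}T_2\lambda_2,\ \chi_{\Gamma_2}T_1\lambda_1),\qquad Gf=(\chi_{\Gamma_1}G_2f,\ \chi_{\Gamma_2}G_1f).$$ **Proposition.** The objects above are well defined: each $v\in\mathcal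 X_{i,0}$ has exactly one extension by zero $v^{\rm ext}\in\mathcal X$; $T_i\lambda$ and $G_if$ exist and are unique for $i=1,2$ and $\lambda\in\mathcal U_i$; and $\chi_{\Gamma_i}(w|_{\Omega_{i'}})$ does not depend on the choice of $w\in\mathcal X$ with the given restriction. Moreover: 1. If $u^\star\in\mathcal X$ solves the global problem $a(u^\star,v)=f(v)$ for all $v\in\mathcal X$, then $\lambda^\star=(u^\star|_{\Gamma_1},u^\star|_{\Gamma_2})\in\mathcal U$ solves the port problem $$a_{\rm p}(\lambda^\star,v)=f_{\rm p}(v)\quad\forall v\in\mathcal U,\qquad a_{\rm p}(\lambda,v):=\langle\lambda-T\lambda,v\rangle,\quad f_{\rm p}(v):=\langle Gf,v\rangle.$$ 2. Conversely, if $\lambda^\star\in\mathcal U$ solves the port problem, then $u^\star=\sum_{i=1}^2(T_i\lambda_i^\star+G_if)\,\phi_i$ (the $i$-th term being zero outside $\Omega_i$) belongs to $\mathcal X$ and solves the global problem. -/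

import Mathlib

open MeasureTheory Set Filter Topology
open scoped ContDiff NNReal

noncomputable section

namespace Schwarz

/-- The space `ℝ^d` with its Euclidean norm. -/
abbrev E (d : ℕ) : Type := EuclideanSpace ℝ (Fin d)

/-- `L²(Ω)`. -/
abbrev L2 {d : ℕ} (Ω : Set (E d)) : Type := Lp ℝ 2 (volume.restrict Ω)

/-- The Hilbert space `L²(Ω) × L²(Ω)^d` of candidate pairs `(u, ∇u)`: the entry `none` is the
function, the entry `some j` is the candidate for its `j`-th weak partial derivative. -/
abbrev Jet {d : ℕ} (Ω : Set (E d)) : Type := PiLp 2 (fun _ : Option (Fin d) => L2 Ω)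

/-- Test functions: smooth functions on `ℝ^d` with compact support contained in `Ω`. -/
def IsTest {d : ℕ} (Ω : Set (E d)) (ψ : E d → ℝ) : Prop :=
  ContDiff ℝ ∞ ψ ∧ HasCompactSupport ψ ∧ tsupport ψ ⊆ Ω

/-- The partial derivative `∂_j ψ`. -/
def pderiv {d : ℕ} (j : Fin d) (ψ : E d → ℝ) (x : E d) : ℝ :=
  fderiv ℝ ψ x (EuclideanSpace.single j 1)

theorem continuous_pderiv {d : ℕ} {ψ : E d → ℝ} (h : ContDiff ℝ ∞ ψ) (j : Fin d) :
    Continuous (pderiv j ψ) :=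
  (h.continuous_fderiv (by simp)).clm_apply continuous_const

theorem IsTest.memLp {d : ℕ} {Ω : Set (E d)} {ψ : E d → ℝ} (h : IsTest Ω ψ)
    (μ : Measure (E d)) [IsFiniteMeasureOnCompacts μ] : MemLp ψ 2 μ :=
  h.1.continuous.memLp_of_hasCompactSupport h.2.1

theorem IsTest.pderiv_memLp {d : ℕ} {Ω : Set (E d)} {ψ : E d → ℝ} (h : IsTest Ω ψ)
    (j : Fin d) (μ : Measure (E d)) [IsFiniteMeasureOnCompacts μ] : MemLp (pderiv j ψ) 2 μ :=
  (continuous_pderiv h.1 j).memLp_of_hasCompactSupport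
    (h.2.1.fderiv_apply (𝕜 := ℝ) (EuclideanSpace.single j 1))

theorem integrable_mul_of_memLp {d : ℕ} {Ω : Set (E d)} (u : L2 Ω) {g : E d → ℝ}
    (hg : MemLp g 2 (volume.restrict Ω)) :
    Integrable (fun x => u x * g x) (volume.restrict Ω) :=
  MemLp.integrable_mul (Lp.memLp u) hg

theorem integral_mul_eq_inner {d : ℕ} {Ω : Set (E d)} (u : L2 Ω) {g : E d → ℝ}
    (hg : MemLp g 2 (volume.restrict Ω)) :
    ∫ x in Ω, u x * g x = inner ℝ (hg.toLp g) u := by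
  rw [L2.inner_def]
  refine integral_congr_ae ?_
  filter_upwards [hg.coeFn_toLp] with x hx
  simp [hx]

/-- The graph of the weak gradient: `(u, ∇u)` with
`∫_Ω u ∂_jψ = -∫_Ω (∂_j u) ψ` for all `j` and all test functions `ψ`. -/
def H1Sub {d : ℕ} (Ω : Set (E d)) : Submodule ℝ (Jet Ω) where
  carrier := {u | ∀ (j : Fin d) (ψ : E d → ℝ), IsTest Ω ψ →
    ∫ x in Ω, u none x * pderiv j ψ x = - ∫ x in Ω, u (some j) x * ψ x}
  zero_mem' := by
    intro j ψ hψ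
    rw [integral_mul_eq_inner _ (hψ.pderiv_memLp j _), integral_mul_eq_inner _ (hψ.memLp _)]
    simp
  add_mem' := by
    intro u v hu hv j ψ hψ
    have h1 := hu j ψ hψ
    have h2 := hv j ψ hψ
    rw [integral_mul_eq_inner _ (hψ.pderiv_memLp j _), integral_mul_eq_inner _ (hψ.memLp _)]
      at h1 h2 ⊢
    simp only [PiLp.add_apply, inner_add_right, h1, h2]
    ring
  smul_mem' := by
    intro c u hu j ψ hψ
    have h1 := hu j ψ hψ
    rw [integral_mul_eq_inner _ (hψ.pderiv_memLp j _), integral_mul_eq_inner _ (hψ.memLp _)]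
      at h1 ⊢
    simp only [PiLp.smul_apply, inner_smul_right, h1]
    ring

/-- The Sobolev space `H¹(Ω)`, with the inner product `(u,v)_{L²} + ∑_j (∂_j u, ∂_j v)_{L²}`. -/
abbrev H1 {d : ℕ} (Ω : Set (E d)) : Type := ↥(H1Sub Ω)

theorem isClosed_H1Sub {d : ℕ} (Ω : Set (E d)) : IsClosed (H1Sub Ω : Set (Jet Ω)) := by
  have : (H1Sub Ω : Set (Jet Ω)) = ⋂ (j : Fin d), ⋂ (ψ : E d → ℝ), ⋂ (_ : IsTest Ω ψ),
      {u : Jet Ω | ∫ x in Ω, u none x * pderiv j ψ x = - ∫ x in Ω, u (some j) x * ψ x} := by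
    ext u
    simp only [mem_iInter, mem_ofPred_eq]
    rfl
  rw [this]
  refine isClosed_iInter fun j => isClosed_iInter fun ψ => isClosed_iInter fun hψ => ?_
  simp only [integral_mul_eq_inner _ (hψ.pderiv_memLp j _), integral_mul_eq_inner _ (hψ.memLp _)]
  refine isClosed_eq ?_ ?_ <;> fun_prop

instance completeSpace_H1 {d : ℕ} (Ω : Set (E d)) : CompleteSpace (H1 Ω) :=
  (isClosed_H1Sub Ω).completeSpace_coe

/-- The function underlying an element of `H¹(Ω)` (a representative; only its values almost
everywhere in `Ω` are meaningful). -/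
def H1.fn {d : ℕ} {Ω : Set (E d)} (u : H1 Ω) : E d → ℝ := (u : Jet Ω) none

/-- `H¹₀(Ω)`: the closure in `H¹(Ω)` of the test functions. -/
def H10 {d : ℕ} (Ω : Set (E d)) : Submodule ℝ (H1 Ω) :=
  (Submodule.span ℝ {u : H1 Ω | ∃ ψ : E d → ℝ, IsTest Ω ψ ∧
    u.fn =ᵐ[volume.restrict Ω] ψ}).topologicalClosure

theorem memLp_restrict {d : ℕ} {S Ω : Set (E d)} (h : S ⊆ Ω) (u : L2 Ω) :
    MemLp (fun x => u x) 2 (volume.restrict S) :=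
  MemLp.mono_measure (Measure.restrict_mono h le_rfl) (Lp.memLp u)

/-- Restriction `L²(Ω) → L²(S)` for `S ⊆ Ω`. -/
def resL2 {d : ℕ} {S Ω : Set (E d)} (h : S ⊆ Ω) : L2 Ω →ₗ[ℝ] L2 S where
  toFun u := (memLp_restrict h u).toLp
  map_add' u v := by
    rw [← MemLp.toLp_add]
    exact (MemLp.toLp_eq_toLp_iff _ _).2
      (ae_mono (Measure.restrict_mono h le_rfl) (Lp.coeFn_add u v))
  map_smul' c u := by
    rw [RingHom.id_apply, ← MemLp.toLp_const_smul c (memLp_restrict h u)]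
    exact (MemLp.toLp_eq_toLp_iff _ _).2
      (ae_mono (Measure.restrict_mono h le_rfl) (Lp.coeFn_smul c u))

theorem resL2_ae {d : ℕ} {S Ω : Set (E d)} (h : S ⊆ Ω) (u : L2 Ω) :
    resL2 h u =ᵐ[volume.restrict S] u :=
  MemLp.coeFn_toLp (memLp_restrict h u)

theorem integral_resL2_mul {d : ℕ} {S Ω : Set (E d)} (h : S ⊆ Ω) (u : L2 Ω) {g : E d → ℝ}
    (hg : ∀ x, x ∉ S → g x = 0) :
    ∫ x in S, resL2 h u x * g x = ∫ x in Ω, u x * g x := by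
  have h1 : ∫ x in S, resL2 h u x * g x = ∫ x in S, u x * g x := by
    refine integral_congr_ae ?_
    filter_upwards [resL2_ae h u] with x hx
    rw [hx]
  rw [h1, setIntegral_eq_integral_of_forall_compl_eq_zero (fun x hx => by simp [hg x hx]),
    setIntegral_eq_integral_of_forall_compl_eq_zero
      (fun x hx => by simp [hg x (fun hS => hx (h hS))])]

/-- Restriction `v ↦ v|_S`, `H¹(Ω) → H¹(S)`, for `S ⊆ Ω`. -/
def res {d : ℕ} {S Ω : Set (E d)} (h : S ⊆ Ω) : H1 Ω →ₗ[ℝ] H1 S where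
  toFun u := ⟨WithLp.toLp 2 (fun k => resL2 h ((u : Jet Ω) k)), by
    intro j ψ hψ
    have h0 : ∀ x, x ∉ S → ψ x = 0 := fun x hx =>
      image_eq_zero_of_notMem_tsupport (fun hx' => hx (hψ.2.2 hx'))
    have h1 : ∀ x, x ∉ S → pderiv j ψ x = 0 := by
      intro x hx
      have : fderiv ℝ ψ x = 0 := by
        by_contra hne
        exact hx (hψ.2.2 (support_fderiv_subset ℝ hne))
      simp [pderiv, this]
    have h2 := u.2 j ψ ⟨hψ.1, hψ.2.1, hψ.2.2.trans h⟩
    change ∫ x in S, resL2 h ((u : Jet Ω) none) x * pderiv j ψ x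
      = - ∫ x in S, resL2 h ((u : Jet Ω) (some j)) x * ψ x
    rw [integral_resL2_mul h _ h1, integral_resL2_mul h _ h0]
    exact h2⟩
  map_add' u v := by
    ext1
    refine PiLp.ext fun k => ?_
    simp
  map_smul' c u := by
    ext1
    refine PiLp.ext fun k => ?_
    simp

/-! ### Traces on a part of the boundary -/

/-- The functions in `H¹(S)` that vanish near `Γ`, i.e. almost everywhere in the part of `S` at
distance less than some `ε > 0` from `Γ`. -/
def vanishNear {d : ℕ} (S Γ : Set (E d)) : Submodule ℝ (H1 S) where
  carrier := {z | ∃ ε > 0, ∀ᵐ x ∂(volume.restrict S), x ∈ Metric.thickening ε Γ → z.fn x = 0}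
  zero_mem' := by
    refine ⟨1, one_pos, ?_⟩
    filter_upwards [Lp.coeFn_zero ℝ 2 (volume.restrict S)] with x hx _
    exact hx
  add_mem' := by
    rintro u v ⟨ε, hε, hu⟩ ⟨δ, hδ, hv⟩
    refine ⟨min ε δ, lt_min hε hδ, ?_⟩
    filter_upwards [hu, hv, Lp.coeFn_add ((u : Jet S) none) ((v : Jet S) none)]
      with x h1 h2 h3 hx
    change ((u : Jet S) none + (v : Jet S) none : L2 S) x = 0
    rw [h3]
    have e1 := h1 (Metric.thickening_mono (min_le_left _ _) _ hx)
    have e2 := h2 (Metric.thickening_mono (min_le_right _ _) _ hx)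
    simp only [H1.fn] at e1 e2
    simp [e1, e2]
  smul_mem' := by
    rintro c u ⟨ε, hε, hu⟩
    refine ⟨ε, hε, ?_⟩
    filter_upwards [hu, Lp.coeFn_smul c ((u : Jet S) none)] with x h1 h2 hx
    change (c • (u : Jet S) none : L2 S) x = 0
    rw [h2]
    have e1 := h1 hx
    simp only [H1.fn] at e1
    simp [e1]

/-- The functions in `H¹(S)` with zero trace on `Γ`: the closure in `H¹(S)` of the functions that
vanish near `Γ`. -/
def zeroTrace {d : ℕ} (S Γ : Set (E d)) : Submodule ℝ (H1 S) :=
  (vanishNear S Γ).topologicalClosure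

instance {d : ℕ} (S Γ : Set (E d)) : (zeroTrace S Γ).HasOrthogonalProjection :=
  haveI : CompleteSpace (zeroTrace S Γ) :=
    (Submodule.isClosed_topologicalClosure (vanishNear S Γ)).completeSpace_coe
  Submodule.HasOrthogonalProjection.ofCompleteSpace (zeroTrace S Γ)

/-- The trace space `H^{1/2}(Γ)` of `H¹(S)` on `Γ`: two functions have the same trace if and only
if their difference has zero trace. -/
abbrev HHalf {d : ℕ} (S Γ : Set (E d)) : Type := H1 S ⧸ zeroTrace S Γ

/-- The trace `v ↦ v|_Γ`. -/
def trace {d : ℕ} (S Γ : Set (E d)) : H1 S →ₗ[ℝ] HHalf S Γ := (zeroTrace S Γ).mkQ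

/-- The lifting of minimal norm: `minLift (v|_Γ)` is the element of minimal `H¹(S)`-norm among all
functions with the same trace as `v`, i.e. the component of `v` orthogonal to the functions with
zero trace. -/
def minLift {d : ℕ} (S Γ : Set (E d)) : HHalf S Γ →ₗ[ℝ] H1 S :=
  (zeroTrace S Γ).liftQ (LinearMap.id - (zeroTrace S Γ).starProjection.toLinearMap) (by
    intro x hx
    have : (zeroTrace S Γ).starProjection x = x := Submodule.starProjection_eq_self_iff.2 hx
    simp [this])

/-- The inner product of `H^{1/2}(Γ)` that induces the norm
`‖λ‖ = inf {‖v‖_{H¹(S)} : v|_Γ = λ}`. -/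
def halfInner {d : ℕ} (S Γ : Set (E d)) (lam mu : HHalf S Γ) : ℝ :=
  inner ℝ (minLift S Γ lam) (minLift S Γ mu)

/-! ### Two overlapping subdomains -/

/-- A bounded open set `Ω = Ω₁ ∪ Ω₂` with open subdomains `Ω₁`, `Ω₂` (`sub 0` and `sub 1`). -/
structure Decomp (d : ℕ) where
  Ω : Set (E d)
  sub : Fin 2 → Set (E d)
  isOpen_Ω : IsOpen Ω
  isBounded_Ω : Bornology.IsBounded Ω
  isOpen_sub : ∀ i, IsOpen (sub i)
  subset : ∀ i, sub i ⊆ Ω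
  cover : Ω = ⋃ i, sub i

/-- The port `Γ_i`, the part of `∂Ω_i` inside `Ω`. -/
def Decomp.port {d : ℕ} (D : Decomp d) (i : Fin 2) : Set (E d) := frontier (D.sub i) ∩ D.Ω

/-- A Lipschitz partition of unity subordinate to `Ω₁, Ω₂`. -/
structure IsPoU {d : ℕ} (D : Decomp d) (φ : Fin 2 → E d → ℝ) : Prop where
  lipschitz : ∀ i, ∃ K : ℝ≥0, LipschitzOnWith K (φ i) D.Ω
  sum_eq_one : ∀ x ∈ D.Ω, ∑ i, φ i x = 1
  nonneg : ∀ i, ∀ x ∈ D.Ω, 0 ≤ φ i x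
  le_one : ∀ i, ∀ x ∈ D.Ω, φ i x ≤ 1
  eq_zero : ∀ i, ∀ x ∈ D.Ω, x ∉ D.sub i → φ i x = 0

section Spaces

variable {d : ℕ} (D : Decomp d) (X : Submodule ℝ (H1 D.Ω))

/-- The local space `X_i = {v|_{Ω_i} : v ∈ X}`. -/
def locSpace (i : Fin 2) : Submodule ℝ (H1 (D.sub i)) := X.map (res (D.subset i))

/-- Restriction `X → X_i`. -/
def locRes (i : Fin 2) (w : X) : locSpace D X i :=
  ⟨res (D.subset i) w, Submodule.mem_map_of_mem w.2⟩

/-- The bubble space `X_{i,0} = {v ∈ X_i : v|_{Γ_i} = 0}`. -/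
def bubble (i : Fin 2) : Submodule ℝ (H1 (D.sub i)) :=
  locSpace D X i ⊓ zeroTrace (D.sub i) (D.port i)

/-- The port space `U_i = {v|_{Γ_i} : v ∈ X_i}`. -/
def portSpace (i : Fin 2) : Submodule ℝ (HHalf (D.sub i) (D.port i)) :=
  (locSpace D X i).map (trace (D.sub i) (D.port i))

/-- The trace `X_i → U_i`, `v ↦ v|_{Γ_i}`. -/
def locTrace (i : Fin 2) (v : locSpace D X i) : portSpace D X i :=
  ⟨trace (D.sub i) (D.port i) v, Submodule.mem_map_of_mem v.2⟩

/-- `IsExt D i v w`: the function `w` is the trivial extension `v^ext` of `v` to `Ω`, equal to `v`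
in `Ω_i` and to zero in `Ω \ Ω_i`. -/
def IsExt (i : Fin 2) (v : H1 (D.sub i)) (w : H1 D.Ω) : Prop :=
  w.fn =ᵐ[volume.restrict D.Ω] (D.sub i).indicator v.fn

/-- The trace `u|_{Γ_i}` of a function `u ∈ X`. -/
def globTrace (i : Fin 2) (u : X) : portSpace D X i := locTrace D X i (locRes D X i u)

theorem exists_glob {i : Fin 2} (v : locSpace D X i) : ∃ w : X, locRes D X i w = v := by
  obtain ⟨w, hw, hwv⟩ := v.2
  exact ⟨⟨w, hw⟩, Subtype.ext hwv⟩

/-- The trace operator `χ_{Γ_i}` from the functions on the other subdomain (which contains `Γ_i`)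
to `U_i`: the trace on `Γ_i` of any element of `X` that restricts to the given function. -/
def chi (i : Fin 2) (v : locSpace D X i.rev) : portSpace D X i :=
  globTrace D X i (exists_glob D X v).choose

/-- The local bilinear forms `a : X_i × X_{i,0} → ℝ`. -/
abbrev LocForms : Type :=
  ∀ i : Fin 2, locSpace D X i →ₗ[ℝ] bubble D X i →ₗ[ℝ] ℝ

variable {D X}

/-- `u = T_i λ`: `u ∈ X_i`, `u|_{Γ_i} = λ` and `a(u, v) = 0` for all `v ∈ X_{i,0}`. -/
def IsT (b : LocForms D X) (i : Fin 2) (lam : portSpace D X i) (u : locSpace D X i) : Prop :=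
  locTrace D X i u = lam ∧ ∀ v : bubble D X i, b i u v = 0

/-- `u = G_i f`: `u ∈ X_i`, `u|_{Γ_i} = 0` and `a(u, v) = f(v) := f(v^ext)` for all
`v ∈ X_{i,0}`. -/
def IsG (b : LocForms D X) (f : X →L[ℝ] ℝ) (i : Fin 2) (u : locSpace D X i) : Prop :=
  locTrace D X i u = 0 ∧
    ∀ (v : bubble D X i) (w : X), IsExt D i v w → b i u v = f w

open Classical in
/-- The local solution operator `T_i : U_i → X_i`. -/
def opT (b : LocForms D X) (i : Fin 2) (lam : portSpace D X i) : locSpace D X i :=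
  if h : ∃ u, IsT b i lam u then h.choose else 0

open Classical in
/-- The local solution operator `G_i`. -/
def opG (b : LocForms D X) (i : Fin 2) (f : X →L[ℝ] ℝ) : locSpace D X i :=
  if h : ∃ u, IsG b f i u then h.choose else 0

/-- The space `U = U₁ × U₂`. -/
abbrev Port (D : Decomp d) (X : Submodule ℝ (H1 D.Ω)) : Type := ∀ i : Fin 2, portSpace D X i

/-- The inner product `⟨w, v⟩ = ∑_i (w_i, v_i)_{H^{1/2}(Γ_i)}` on `U`. -/
def portInner (w v : Port D X) : ℝ :=
  ∑ i, halfInner (D.sub i) (D.port i) (w i) (v i)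

/-- `T λ = (χ_{Γ₁} T₂ λ₂, χ_{Γ₂} T₁ λ₁)`. -/
def portT (b : LocForms D X) (lam : Port D X) : Port D X :=
  fun i => chi D X i (opT b i.rev (lam i.rev))

/-- `G f = (χ_{Γ₁} G₂ f, χ_{Γ₂} G₁ f)`. -/
def portG (b : LocForms D X) (f : X →L[ℝ] ℝ) : Port D X :=
  fun i => chi D X i (opG b i.rev f)

/-- `a_p(λ, v) = ⟨λ - T λ, v⟩`. -/
def aPort (b : LocForms D X) (lam v : Port D X) : ℝ := portInner (lam - portT b lam) v

/-- `f_p(v) = ⟨G f, v⟩`. -/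
def fPort (b : LocForms D X) (f : X →L[ℝ] ℝ) (v : Port D X) : ℝ := portInner (portG b f) v

/-- `λ` solves the port problem `a_p(λ, v) = f_p(v)` for all `v ∈ U`. -/
def SolvesPort (b : LocForms D X) (f : X →L[ℝ] ℝ) (lam : Port D X) : Prop :=
  ∀ v : Port D X, aPort b lam v = fPort b f v

/-- `u` solves the global problem `a(u, v) = f(v)` for all `v ∈ X`. -/
def SolvesGlobal (a : X →ₗ[ℝ] X →ₗ[ℝ] ℝ) (f : X →L[ℝ] ℝ) (u : X) : Prop :=
  ∀ v : X, a u v = f v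

end Spaces

end Schwarz

end

/-! The form `⟨·,·⟩` is definite on `U`, so the port problem is the fixed point equation `λ = Tλ +
Gf`. With `u_i = T_i λ_i + G_i f`, it says that the local solutions `u_1`, `u_2` have equal traces
on each port. If `u` solves the global problem, locality and local uniqueness give `u|_{Ω_i} = u_i`,
and the traces match because `χ` does not depend on the lift (`IsPoU.chi_locRes`).

Conversely, lift `u_i` to `w_i ∈ X`. The difference `z = w_{i'} - w_i` has zero trace on both ports
and is `a`-orthogonal to every function supported in the overlap. Let `y_i` be the zero extension of
`z|_{Ω_i}`. Then `t = y_1 + y_2 - z` equals `z` on the overlap and `0` elsewhere, so it is an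
admissible test function, and locality gives `a(t,t) = a(z,t) + a(z,t) - a(z,t) = 0`. Hence `z = 0`
on the overlap (`IsPoU.ae_eq_zero_overlap`), and `∑ φ_i w_i` agrees with `w_i` on all of `Ω_i`.
Splitting a test function as `v = φ_1 v + φ_2 v` then gives the global equation.

Three facts on `H¹` carry this: zero extension across a port (`exists_ext_of_zeroTrace`), zero trace
of `φ_i v` on `Γ_i` (`mem_zeroTrace_of_lipschitz_mul`), and zero trace on `Γ_i` of functions
vanishing on `Ω_{i'}` (`IsPoU.mem_zeroTrace_of_vanish`). Lipschitz factors are handled by weak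
compactness: approximants bounded in `H¹` and convergent in `L²` suffice, so no almost everywhere
derivative of `φ_i` is needed. -/

noncomputable section

namespace Schwarz

/-! ### Two Hilbert space facts -/

/-- A bounded sequence in a closed subspace `Z` whose image under `J` converges has a weak cluster
point in `Z`, whose image is the limit. -/
theorem exists_mem_of_bounded_of_tendsto {H L : Type*} [NormedAddCommGroup H]
    [InnerProductSpace ℝ H] [CompleteSpace H] [NormedAddCommGroup L] [InnerProductSpace ℝ L]
    [CompleteSpace L] (J : H →L[ℝ] L) (Z : Submodule ℝ H) (hZ : IsClosed (Z : Set H))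
    {z : ℕ → H} (hz : ∀ n, z n ∈ Z) {C : ℝ} (hC : ∀ n, ‖z n‖ ≤ C) {g : L}
    (hg : Tendsto (fun n => J (z n)) atTop (𝓝 g)) :
    ∃ w ∈ Z, ‖w‖ ≤ C ∧ J w = g := by
  let F : ℕ → WeakDual ℝ H := fun n =>
    StrongDual.toWeakDual (InnerProductSpace.toDual ℝ H (z n))
  have hF : ∀ n, F n ∈ WeakDual.toStrongDual ⁻¹' Metric.closedBall (0 : StrongDual ℝ H) C := by
    intro n
    simpa [F] using hC n
  obtain ⟨l, hl, hcl⟩ := (WeakDual.isCompact_closedBall (0 : StrongDual ℝ H) C).exists_mapClusterPt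
    (f := atTop) (u := F) (by
      rw [le_principal_iff]
      exact Filter.mem_map.2 (Filter.univ_mem' hF))
  set w : H := (InnerProductSpace.toDual ℝ H).symm (WeakDual.toStrongDual l) with hw
  have hwl : ∀ x, inner ℝ w x = l x := fun x => by
    rw [hw, InnerProductSpace.toDual_symm_apply]; rfl
  have key : ∀ (x : H) (c : ℝ), Tendsto (fun n => inner ℝ (z n) x) atTop (𝓝 c) →
      inner ℝ w x = c := by
    intro x c hc
    have h1 : MapClusterPt (l x) atTop (fun n => F n x) :=
      MapClusterPt.continuousAt_comp (f := fun l : WeakDual ℝ H => l x)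
        (WeakDual.eval_continuous x).continuousAt hcl
    have h2 : Tendsto (fun n => F n x) atTop (𝓝 c) := hc
    rw [hwl]
    -- Compactness yields only a cluster point; along a suitable ultrafilter finer than `atTop` it
    -- is a limit, which must be `c`.
    obtain ⟨U, hU, hUx⟩ := mapClusterPt_iff_ultrafilter.1 h1
    exact tendsto_nhds_unique hUx (h2.mono_left hU)
  refine ⟨w, ?_, ?_, ?_⟩
  · have : CompleteSpace Z := hZ.completeSpace_coe
    -- Since `Z = Zᗮᗮ`, membership is tested by inner products and so survives weak limits.
    rw [← Submodule.orthogonal_orthogonal Z, Submodule.mem_orthogonal']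
    intro x hx
    refine key x 0 ?_
    simp only [fun n => (Submodule.mem_orthogonal Z x).1 hx (z n) (hz n)]
    exact tendsto_const_nhds
  · rw [hw, LinearIsometryEquiv.norm_map]
    simpa using hl
  · refine ext_inner_right ℝ fun h => ?_
    rw [← ContinuousLinearMap.adjoint_inner_right]
    refine key _ _ ?_
    simp only [ContinuousLinearMap.adjoint_inner_right]
    exact hg.inner tendsto_const_nhds

/-- Lax-Milgram on a closed subspace, with an affine shift. -/
theorem exists_solution_of_coercive {H : Type*} [NormedAddCommGroup H]
    [InnerProductSpace ℝ H] [CompleteSpace H] (a : H →ₗ[ℝ] H →ₗ[ℝ] ℝ) {γ α : ℝ} (hα : 0 < α)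
    (ha_cont : ∀ u v, |a u v| ≤ γ * ‖u‖ * ‖v‖) (ha_coer : ∀ v, α * ‖v‖ ^ 2 ≤ a v v)
    (V : Submodule ℝ H) (hV : IsClosed (V : Set H)) (g : H →L[ℝ] ℝ) (w : H) :
    ∃ z ∈ V, ∀ v ∈ V, a (w + z) v = g v := by
  have : CompleteSpace V := hV.completeSpace_coe
  let A : H →L[ℝ] H →L[ℝ] ℝ := a.mkContinuous₂ γ ha_cont
  have hA : ∀ u v, A u v = a u v := fun _ _ => rfl
  let B : V →L[ℝ] V →L[ℝ] ℝ := A.bilinearComp V.subtypeL V.subtypeL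
  have hB : ∀ u v : V, B u v = a u v := fun _ _ => rfl
  have hco : IsCoercive B := ⟨α, hα, fun u => by
    have := ha_coer u
    rw [hB, mul_assoc, ← pow_two]
    exact this⟩
  let l : StrongDual ℝ V := (g - A w).comp V.subtypeL
  let z : V := hco.continuousLinearEquivOfBilin.symm ((InnerProductSpace.toDual ℝ V).symm l)
  refine ⟨z, z.2, fun v hv => ?_⟩
  have h1 := hco.continuousLinearEquivOfBilin_apply z ⟨v, hv⟩
  rw [ContinuousLinearEquiv.apply_symm_apply, InnerProductSpace.toDual_symm_apply, hB] at h1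
  have h2 : l ⟨v, hv⟩ = g v - a w v := rfl
  rw [h2] at h1
  rw [map_add, LinearMap.add_apply, ← h1]
  ring

/-! ### Functions in `H¹` -/

theorem H1.fn_add {d : ℕ} {S : Set (E d)} (u v : H1 S) :
    (u + v).fn =ᵐ[volume.restrict S] fun x => u.fn x + v.fn x :=
  Lp.coeFn_add ((u : Jet S) none) ((v : Jet S) none)

theorem H1.fn_sub {d : ℕ} {S : Set (E d)} (u v : H1 S) :
    (u - v).fn =ᵐ[volume.restrict S] fun x => u.fn x - v.fn x :=
  Lp.coeFn_sub ((u : Jet S) none) ((v : Jet S) none)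

theorem res_fn {d : ℕ} {S Ω : Set (E d)} (h : S ⊆ Ω) (u : H1 Ω) :
    (res h u).fn =ᵐ[volume.restrict S] u.fn :=
  resL2_ae h _

/-- The underlying function, as a bounded operator `H¹(S) → L²(S)`. -/
def toL2 {d : ℕ} (S : Set (E d)) : H1 S →L[ℝ] L2 S :=
  (PiLp.proj 2 (fun _ : Option (Fin d) => L2 S) none).comp (H1Sub S).subtypeL

/-- The weak gradient vanishes where the function does. -/
theorem H1.grad_ae_eq_zero {d : ℕ} {S U : Set (E d)} (hU : IsOpen U) (hUS : U ⊆ S) (u : H1 S)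
    (h : ∀ᵐ x ∂(volume.restrict S), x ∈ U → u.fn x = 0) (j : Fin d) :
    ∀ᵐ x ∂(volume.restrict S), x ∈ U → (u : Jet S) (some j) x = 0 := by
  refine hU.ae_eq_zero_of_integral_contDiff_smul_eq_zero ?_ ?_
  · exact ((Lp.memLp ((u : Jet S) (some j))).locallyIntegrable (by norm_num)).locallyIntegrableOn _
  · intro g hg hgc hgU
    -- For `g` supported in `U`, the product of `u` and `∂_j g` vanishes, hence so does the integral
    -- of `(∂_j u) g`.
    have h1 := u.2 j g ⟨hg, hgc, hgU.trans hUS⟩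
    have h2 : ∫ x in S, (u : Jet S) none x * pderiv j g x = 0 := by
      refine integral_eq_zero_of_ae ?_
      filter_upwards [h] with x hx
      by_cases hxU : x ∈ U
      · have := hx hxU
        simp only [H1.fn] at this
        simp [this]
      · have : fderiv ℝ g x = 0 := by
          by_contra hne
          exact hxU (hgU (support_fderiv_subset ℝ hne))
        simp [pderiv, this]
    rw [h2] at h1
    simp only [smul_eq_mul, mul_comm (g _)]
    linarith

/-- On an open set the weak gradient is determined by the function, so elements of `H¹` can be
compared through `fn` alone. -/
theorem H1.ext_fn {d : ℕ} {S : Set (E d)} (hS : IsOpen S) {u v : H1 S}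
    (h : u.fn =ᵐ[volume.restrict S] v.fn) : u = v := by
  rw [← sub_eq_zero]
  have h0 : (u - v).fn =ᵐ[volume.restrict S] 0 := by
    filter_upwards [h, H1.fn_sub u v] with x h1 h2
    simp [h2, h1]
  ext1
  refine PiLp.ext fun k => ?_
  refine Lp.ext ?_
  refine EventuallyEq.trans ?_ (Lp.coeFn_zero ℝ 2 (volume.restrict S)).symm
  cases k with
  | none => exact h0
  | some j =>
    filter_upwards [H1.grad_ae_eq_zero hS subset_rfl (u - v) (by
      filter_upwards [h0] with x hx _ using hx) j, ae_restrict_mem hS.measurableSet] with x h1 h2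
    exact h1 h2

theorem norm_resL2_le {d : ℕ} {S Ω : Set (E d)} (h : S ⊆ Ω) (u : L2 Ω) : ‖resL2 h u‖ ≤ ‖u‖ := by
  have h1 : ‖resL2 h u‖ = (eLpNorm u 2 (volume.restrict S)).toReal :=
    Lp.norm_toLp _ (memLp_restrict h u)
  rw [h1, Lp.norm_def]
  exact ENNReal.toReal_mono (Lp.eLpNorm_ne_top u)
    (eLpNorm_mono_measure _ (Measure.restrict_mono h le_rfl))

theorem continuous_resL2 {d : ℕ} {S Ω : Set (E d)} (h : S ⊆ Ω) : Continuous (resL2 h) :=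
  AddMonoidHomClass.continuous_of_bound (resL2 h) 1 (by simpa using norm_resL2_le h)

theorem continuous_res {d : ℕ} {S Ω : Set (E d)} (h : S ⊆ Ω) : Continuous (res h) := by
  refine Continuous.subtype_mk ?_ _
  refine (PiLp.continuous_toLp 2 _).comp (continuous_pi fun k => ?_)
  exact (continuous_resL2 h).comp
    ((PiLp.continuous_apply 2 (fun _ : Option (Fin d) => L2 Ω) k).comp continuous_subtype_val)

theorem isClosed_zeroTrace {d : ℕ} (S Γ : Set (E d)) :
    IsClosed (zeroTrace S Γ : Set (H1 S)) :=
  Submodule.isClosed_topologicalClosure _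

/-! ### Multiplication by Lipschitz functions -/

theorem pderiv_mul {d : ℕ} {η ψ : E d → ℝ} (hη : ContDiff ℝ ∞ η) (hψ : ContDiff ℝ ∞ ψ)
    (j : Fin d) (x : E d) :
    pderiv j (fun x => η x * ψ x) x = η x * pderiv j ψ x + pderiv j η x * ψ x := by
  have h1 : DifferentiableAt ℝ η x := (hη.differentiable (by simp)).differentiableAt
  have h2 : DifferentiableAt ℝ ψ x := (hψ.differentiable (by simp)).differentiableAt
  simp only [pderiv]
  rw [fderiv_fun_mul h1 h2]
  simp [mul_comm]

theorem norm_toLp_le {d : ℕ} {S : Set (E d)} (u : L2 S) {g : E d → ℝ}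
    (hg : MemLp g 2 (volume.restrict S)) {M : ℝ}
    (h : ∀ᵐ x ∂(volume.restrict S), |g x| ≤ M * |u x|) : ‖hg.toLp g‖ ≤ M * ‖u‖ := by
  refine Lp.norm_le_mul_norm_of_ae_le_mul ?_
  filter_upwards [h, hg.coeFn_toLp] with x h1 h2
  rw [h2]
  exact h1

theorem memLp_mul_of_bounded {d : ℕ} {S : Set (E d)} (hS : IsOpen S) (u : L2 S) {η : E d → ℝ}
    (hη : ContinuousOn η S) {M : ℝ} (hM : ∀ x ∈ S, |η x| ≤ M) :
    MemLp (fun x => η x * u x) 2 (volume.restrict S) := by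
  refine (Lp.memLp u).of_le_mul (c := M)
    ((hη.aestronglyMeasurable hS.measurableSet).mul (Lp.aestronglyMeasurable u)) ?_
  filter_upwards [ae_restrict_mem hS.measurableSet] with x hx
  rw [norm_mul]
  exact mul_le_mul_of_nonneg_right (hM x hx) (norm_nonneg _)

theorem norm_jet_le {d : ℕ} {S : Set (E d)} (z : Jet S) {B : ℝ} (h : ∀ k, ‖z k‖ ≤ B) :
    ‖z‖ ≤ √(d + 1) * B := by
  have hB : 0 ≤ B := (norm_nonneg _).trans (h none)
  rw [PiLp.norm_eq_of_L2, ← Real.sqrt_sq hB, ← Real.sqrt_mul (by positivity)]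
  refine Real.sqrt_le_sqrt ?_
  calc ∑ k, ‖z k‖ ^ 2 ≤ ∑ _k : Option (Fin d), B ^ 2 :=
        Finset.sum_le_sum fun k _ => pow_le_pow_left₀ (norm_nonneg _) (h k) 2
    _ = (d + 1) * B ^ 2 := by simp

theorem norm_apply_le {d : ℕ} {S : Set (E d)} (u : H1 S) (k : Option (Fin d)) :
    ‖(u : Jet S) k‖ ≤ ‖u‖ :=
  PiLp.norm_apply_le (u : Jet S) k

theorem abs_pderiv_le {d : ℕ} {η : E d → ℝ} {K : ℝ≥0} (h : LipschitzWith K η) (j : Fin d)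
    (x : E d) : |pderiv j η x| ≤ K := by
  have h1 := (fderiv ℝ η x).le_opNorm (EuclideanSpace.single j 1)
  have h2 : ‖fderiv ℝ η x‖ ≤ K := norm_fderiv_le_of_lipschitz ℝ h
  simp only [PiLp.norm_single, norm_one, mul_one] at h1
  exact h1.trans h2

/-- The product of a smooth function with bounded values and gradient and a function in `H¹`. -/
theorem exists_smooth_mul {d : ℕ} {S : Set (E d)} (hS : IsOpen S) {η : E d → ℝ}
    (hη : ContDiff ℝ ∞ η) {K : ℝ≥0} (hK : LipschitzWith K η) {M : ℝ} (hM0 : 0 ≤ M)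
    (hM : ∀ x ∈ S, |η x| ≤ M) (u : H1 S) :
    ∃ z : H1 S, z.fn =ᵐ[volume.restrict S] (fun x => η x * u.fn x) ∧
      ‖z‖ ≤ √(d + 1) * ((M + K) * ‖u‖) := by
  have m1 : ∀ k, MemLp (fun x => η x * (u : Jet S) k x) 2 (volume.restrict S) := fun k =>
    memLp_mul_of_bounded hS _ hη.continuous.continuousOn hM
  have m2 : ∀ j, MemLp (fun x => pderiv j η x * (u : Jet S) none x) 2 (volume.restrict S) :=
    fun j => memLp_mul_of_bounded hS _ (continuous_pderiv hη j).continuousOn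
      fun x _ => abs_pderiv_le hK j x
  let w : Jet S := WithLp.toLp 2 fun k => match k with
    | none => (m1 none).toLp
    | some j => (m1 (some j)).toLp + (m2 j).toLp
  have w0 : w none = (m1 none).toLp := rfl
  have w1 : ∀ j, w (some j) = (m1 (some j)).toLp + (m2 j).toLp := fun _ => rfl
  have e0 := (m1 none).coeFn_toLp
  have e1 : ∀ j, w (some j) =ᵐ[volume.restrict S] fun x =>
      η x * (u : Jet S) (some j) x + pderiv j η x * (u : Jet S) none x := by
    intro j
    rw [w1]
    filter_upwards [Lp.coeFn_add (m1 (some j)).toLp (m2 j).toLp, (m1 (some j)).coeFn_toLp,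
      (m2 j).coeFn_toLp] with x h1 h2 h3
    rw [h1, Pi.add_apply, h2, h3]
  have hw : w ∈ H1Sub S := by
    intro j ψ hψ
    -- The product rule is dual to `∂_j(ηψ) = η ∂_jψ + (∂_jη) ψ`, obtained by testing `u` with `ηψ`.
    have hηψ : IsTest S (fun x => η x * ψ x) :=
      ⟨hη.mul hψ.1, hψ.2.1.mul_left,
        (closure_mono (Function.support_mul_subset_right _ _)).trans hψ.2.2⟩
    have h1 := u.2 j _ hηψ
    have i1 : MemLp (fun x => η x * pderiv j ψ x) 2 (volume.restrict S) :=
      (hη.continuous.mul (continuous_pderiv hψ.1 j)).memLp_of_hasCompactSupport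
        (HasCompactSupport.mul_left (hψ.2.1.fderiv_apply (𝕜 := ℝ) (EuclideanSpace.single j 1)))
    have i2 : MemLp (fun x => pderiv j η x * ψ x) 2 (volume.restrict S) :=
      ((continuous_pderiv hη j).mul hψ.1.continuous).memLp_of_hasCompactSupport hψ.2.1.mul_left
    have I1 := integrable_mul_of_memLp ((u : Jet S) none) i1
    have I2 := integrable_mul_of_memLp ((u : Jet S) none) i2
    have I3 := integrable_mul_of_memLp ((u : Jet S) (some j)) (hηψ.memLp _)
    have h2 : ∫ x in S, (u : Jet S) none x * pderiv j (fun x => η x * ψ x) x =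
        (∫ x in S, (u : Jet S) none x * (η x * pderiv j ψ x)) +
          ∫ x in S, (u : Jet S) none x * (pderiv j η x * ψ x) := by
      rw [← integral_add I1 I2]
      simp only [pderiv_mul hη hψ.1, mul_add]
    have h3 : ∫ x in S, w none x * pderiv j ψ x =
        ∫ x in S, (u : Jet S) none x * (η x * pderiv j ψ x) := by
      refine integral_congr_ae ?_
      filter_upwards [e0] with x hx
      rw [w0, hx]
      ring
    have h4 : ∫ x in S, w (some j) x * ψ x =
        (∫ x in S, (u : Jet S) (some j) x * (η x * ψ x)) +
          ∫ x in S, (u : Jet S) none x * (pderiv j η x * ψ x) := by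
      rw [← integral_add I3 I2]
      refine integral_congr_ae ?_
      filter_upwards [e1 j] with x hx
      rw [hx]
      ring
    rw [h3, h4]
    linarith
  refine ⟨⟨w, hw⟩, e0, norm_jet_le w fun k => ?_⟩
  have n1 : ∀ k, ‖(m1 k).toLp‖ ≤ M * ‖u‖ := fun k =>
    (norm_toLp_le _ (m1 k) (by
      filter_upwards [ae_restrict_mem hS.measurableSet] with x hx
      rw [abs_mul]
      exact mul_le_mul_of_nonneg_right (hM x hx) (abs_nonneg _))).trans
      (mul_le_mul_of_nonneg_left (norm_apply_le u k) hM0)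
  have n2 : ∀ j, ‖(m2 j).toLp‖ ≤ K * ‖u‖ := fun j =>
    (norm_toLp_le _ (m2 j) (Eventually.of_forall fun x => by
      rw [abs_mul]
      exact mul_le_mul_of_nonneg_right (abs_pderiv_le hK j x) (abs_nonneg _))).trans
      (mul_le_mul_of_nonneg_left (norm_apply_le u none) K.2)
  cases k with
  | none =>
    rw [w0, add_mul]
    exact (n1 none).trans (le_add_of_nonneg_right (by positivity))
  | some j =>
    rw [w1, add_mul]
    exact (norm_add_le _ _).trans (add_le_add (n1 _) (n2 j))

/-- Smooth uniform approximation of a Lipschitz function with the same Lipschitz constant. -/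
theorem exists_smooth_approx {d : ℕ} {η : E d → ℝ} {K : ℝ≥0} (hK : LipschitzWith K η) {ε : ℝ}
    (hε : 0 < ε) :
    ∃ ζ : E d → ℝ, ContDiff ℝ ∞ ζ ∧ LipschitzWith K ζ ∧ ∀ x, |ζ x - η x| ≤ ε := by
  -- Averaging over a ball of radius `r` moves `η` by at most `K r ≤ ε`; the `+ 1` covers `K = 0`.
  set r : ℝ := ε / (K + 1) with hr
  have hr0 : 0 < r := by positivity
  let ρ : ContDiffBump (0 : E d) := ⟨r / 2, r, by positivity, by linarith⟩
  have hc : Continuous η := hK.continuous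
  have hex : ConvolutionExists (ρ.normed volume) η (ContinuousLinearMap.lsmul ℝ ℝ) volume :=
    ρ.hasCompactSupport_normed.convolutionExists_left _ ρ.continuous_normed hc.locallyIntegrable
  refine ⟨convolution (ρ.normed volume) η (ContinuousLinearMap.lsmul ℝ ℝ) volume, ?_, ?_, ?_⟩
  · exact ρ.hasCompactSupport_normed.contDiff_convolution_left _ ρ.contDiff_normed
      hc.locallyIntegrable
  · refine LipschitzWith.of_dist_le_mul fun x y => ?_
    -- Averaging translates of `η` with a nonnegative kernel of mass one keeps the Lipschitz
    -- constant.
    have h1 : convolution (ρ.normed volume) η (ContinuousLinearMap.lsmul ℝ ℝ) volume x -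
        convolution (ρ.normed volume) η (ContinuousLinearMap.lsmul ℝ ℝ) volume y =
        ∫ t, ρ.normed volume t * (η (x - t) - η (y - t)) := by
      simp only [convolution_def]
      rw [← integral_sub (hex x) (hex y)]
      simp [mul_sub]
    rw [Real.dist_eq, h1]
    have h2 : ∀ t, ‖ρ.normed volume t * (η (x - t) - η (y - t))‖ ≤
        ρ.normed volume t * (K * dist x y) := fun t => by
      rw [norm_mul, Real.norm_of_nonneg (ρ.nonneg_normed t), Real.norm_eq_abs, ← Real.dist_eq]
      refine mul_le_mul_of_nonneg_left ?_ (ρ.nonneg_normed t)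
      simpa using hK.dist_le_mul (x - t) (y - t)
    refine (norm_integral_le_of_norm_le (ρ.integrable_normed.mul_const _)
      (Eventually.of_forall h2)).trans ?_
    rw [integral_mul_const, ρ.integral_normed, one_mul]
  · intro x
    refine ρ.dist_normed_convolution_le hc.aestronglyMeasurable fun y hy => ?_
    refine (hK.dist_le_mul y x).trans ?_
    have h1 : dist y x ≤ r := (Metric.mem_ball.1 hy).le
    calc (K : ℝ) * dist y x ≤ (K + 1) * r := by gcongr; simp
      _ = ε := by rw [hr]; field_simp

/-- If `|f_n - f| ≤ ε_n |u|` with `ε_n → 0`, then `f_n → f` in `L²`. -/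
theorem tendsto_L2_of_ae_le {d : ℕ} {S : Set (E d)} {f : ℕ → L2 S} {g u : L2 S} {ε : ℕ → ℝ}
    (hε : Tendsto ε atTop (𝓝 0))
    (h : ∀ n, ∀ᵐ x ∂(volume.restrict S), |f n x - g x| ≤ ε n * |u x|) :
    Tendsto f atTop (𝓝 g) := by
  rw [tendsto_iff_norm_sub_tendsto_zero]
  refine squeeze_zero (fun _ => norm_nonneg _) (fun n => ?_)
    (by simpa using hε.mul_const ‖u‖)
  refine Lp.norm_le_mul_norm_of_ae_le_mul ?_
  filter_upwards [h n, Lp.coeFn_sub (f n) g] with x h1 h2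
  rw [h2]
  exact h1

/-- The product of a bounded Lipschitz function and a function in `H¹`. -/
theorem exists_lipschitz_mul {d : ℕ} {S : Set (E d)} (hS : IsOpen S) {η : E d → ℝ}
    {K : ℝ≥0} (hK : LipschitzWith K η) {M : ℝ} (hM0 : 0 ≤ M)
    (hM : ∀ x ∈ S, |η x| ≤ M) (u : H1 S) :
    ∃ z : H1 S, z.fn =ᵐ[volume.restrict S] (fun x => η x * u.fn x) ∧
      ‖z‖ ≤ √(d + 1) * ((M + 1 + K) * ‖u‖) := by
  choose ζ hζ hζK hζη using fun n : ℕ =>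
    exists_smooth_approx hK (ε := 1 / ((n : ℝ) + 1)) (by positivity)
  have hb : ∀ n, ∀ x ∈ S, |ζ n x| ≤ M + 1 := fun n x hx => by
    have h1 := hM x hx
    have h2 : 1 / ((n : ℝ) + 1) ≤ 1 := by
      rw [div_le_one (by positivity)]
      simp
    have h3 := hζη n x
    have h4 : ζ n x = η x + (ζ n x - η x) := by ring
    rw [h4]
    exact (abs_add_le _ _).trans (by linarith)
  choose z hz hzn using fun n => exists_smooth_mul hS (hζ n) (hζK n) (by linarith) (hb n) u
  have m := memLp_mul_of_bounded hS ((u : Jet S) none) hK.continuous.continuousOn hM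
  -- The smooth products are bounded in `H¹` because the constants `K` and `M + 1` are uniform in
  -- `n`; their `L²` limit `η u` therefore lies in `H¹`.
  obtain ⟨w, -, hwn, hw⟩ := exists_mem_of_bounded_of_tendsto (toL2 S) ⊤ isClosed_univ
    (fun n => Submodule.mem_top (x := z n)) hzn (g := m.toLp) (by
      refine tendsto_L2_of_ae_le (u := (u : Jet S) none)
        tendsto_one_div_add_atTop_nhds_zero_nat fun n => ?_
      filter_upwards [hz n, m.coeFn_toLp] with x h1 h2
      change |(z n).fn x - _| ≤ _
      rw [h1, h2]
      change |ζ n x * (u : Jet S) none x - _| ≤ _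
      rw [← sub_mul, abs_mul]
      exact mul_le_mul_of_nonneg_right (hζη n x) (abs_nonneg _))
  refine ⟨w, ?_, hwn⟩
  have h1 := m.coeFn_toLp
  rw [← hw] at h1
  exact h1

/-- A Lipschitz function that vanishes on `Γ` times a function in `H¹(S)` has zero trace
on `Γ`. -/
theorem mem_zeroTrace_of_lipschitz_mul {d : ℕ} {S Γ : Set (E d)} (hS : IsOpen S) {η : E d → ℝ}
    {K : ℝ≥0} (hK : LipschitzWith K η) {M : ℝ} (hM : ∀ x ∈ S, |η x| ≤ M)
    (hη0 : ∀ x ∈ S, 0 ≤ η x) (hΓ : ∀ x ∈ Γ, η x = 0) (u z : H1 S)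
    (hz : z.fn =ᵐ[volume.restrict S] fun x => η x * u.fn x) :
    z ∈ zeroTrace S Γ := by
  let ε : ℕ → ℝ := fun n => 1 / ((n : ℝ) + 1)
  have hε : ∀ n, 0 < ε n := fun n => by positivity
  -- The truncation `(η - ε_n)⁺` keeps the Lipschitz constant and vanishes wherever `η ≤ ε_n`, in
  -- particular at the points of `S` within `ε_n / (K + 1)` of `Γ`.
  let θ : ℕ → E d → ℝ := fun n x => max (η x - ε n) 0
  have hθK : ∀ n, LipschitzWith K (θ n) := fun n => by
    refine LipschitzWith.max_const ?_ 0
    refine LipschitzWith.of_dist_le_mul fun x y => ?_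
    rw [dist_sub_right]
    exact hK.dist_le_mul x y
  have hθη : ∀ n, ∀ x ∈ S, |θ n x - η x| ≤ ε n := fun n x hx => by
    have h0 := hη0 x hx
    have h1 := hε n
    simp only [θ]
    rw [abs_le]
    rcases max_cases (η x - ε n) 0 with h | h <;> constructor <;> linarith
  -- `M` may be negative when `S` is empty, hence `|M|`.
  have hθM : ∀ n, ∀ x ∈ S, |θ n x| ≤ |M| := fun n x hx => by
    have h0 := hη0 x hx
    have h1 := hε n
    have h2 := (hM x hx).trans (le_abs_self M)
    rw [abs_of_nonneg h0] at h2
    rw [abs_of_nonneg (le_max_right _ _)]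
    exact max_le (by linarith) (abs_nonneg _)
  choose w hw hwn using fun n => exists_lipschitz_mul hS (hθK n) (abs_nonneg M) (hθM n) u
  have hmem : ∀ n, w n ∈ zeroTrace S Γ := fun n => by
    refine Submodule.le_topologicalClosure _ ⟨ε n / (K + 1), by have := hε n; positivity, ?_⟩
    filter_upwards [hw n] with x hx hxΓ
    obtain ⟨y, hy, hxy⟩ := Metric.mem_thickening_iff.1 hxΓ
    have h1 := hK.dist_le_mul x y
    rw [hΓ y hy, Real.dist_eq, sub_zero] at h1
    have h2 : η x ≤ ε n := by
      calc η x ≤ K * dist x y := (le_abs_self _).trans h1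
        _ ≤ (K + 1) * (ε n / (K + 1)) := by gcongr; simp
        _ = ε n := by field_simp
    have h3 : θ n x = 0 := max_eq_right (by linarith)
    rw [hx, h3, zero_mul]
  obtain ⟨v, hv, -, hvz⟩ := exists_mem_of_bounded_of_tendsto (toL2 S) _ (isClosed_zeroTrace S Γ)
    hmem hwn (g := toL2 S z) (by
      refine tendsto_L2_of_ae_le (u := (u : Jet S) none)
        tendsto_one_div_add_atTop_nhds_zero_nat fun n => ?_
      filter_upwards [hw n, hz, ae_restrict_mem hS.measurableSet] with x h1 h2 hx
      change |(w n).fn x - z.fn x| ≤ _ * |u.fn x|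
      rw [h1, h2, ← sub_mul, abs_mul]
      exact mul_le_mul_of_nonneg_right (hθη n x hx) (abs_nonneg _))
  have : v = z := H1.ext_fn hS (by
    have : (v : Jet S) none = (z : Jet S) none := hvz
    simp only [H1.fn, this]
    rfl)
  exact this ▸ hv

/-! ### Extension by zero -/

/-- Multiplication by `χ` turns a test function on a larger set into one on `S`. Being `1` in a
neighbourhood of each point of `K`, `χ` has zero derivative there. -/
theorem exists_smooth_cutoff {d : ℕ} {S K : Set (E d)} (hS : IsOpen S) (hK : IsClosed K)
    (hKS : K ⊆ S) :
    ∃ χ : E d → ℝ, ContDiff ℝ ∞ χ ∧ tsupport χ ⊆ S ∧ ∀ x ∈ K, χ =ᶠ[𝓝 x] 1 := by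
  obtain ⟨χ, h0, h1, -⟩ := exists_contMDiffMap_zero_one_nhds_of_isClosed (n := ⊤)
    (modelWithCornersSelf ℝ (E d)) hS.isClosed_compl hK (disjoint_compl_left_iff_subset.2 hKS)
  refine ⟨χ, χ.contMDiff.contDiff, fun x hx => ?_, fun x hx => ?_⟩
  · by_contra hxS
    have h2 : ∀ᶠ y in 𝓝 x, χ y = 0 := h0.filter_mono (nhds_le_nhdsSet hxS)
    exact (notMem_tsupport_iff_eventuallyEq.2 h2) hx
  · exact h1.filter_mono (nhds_le_nhdsSet hx)

/-- The integration by parts formula for functions with zero trace on `∂S ∩ Ω`, with test functions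
that need not vanish near `∂S`. -/
theorem integral_mul_pderiv_of_zeroTrace {d : ℕ} {S Ω : Set (E d)} (hS : IsOpen S)
    (v : H1 S) (hv : v ∈ zeroTrace S (frontier S ∩ Ω)) (j : Fin d) (ψ : E d → ℝ)
    (hψ : IsTest Ω ψ) :
    ∫ x in S, (v : Jet S) none x * pderiv j ψ x = - ∫ x in S, (v : Jet S) (some j) x * ψ x := by
  revert v
  have hcl : IsClosed {v : H1 S | ∫ x in S, (v : Jet S) none x * pderiv j ψ x =
      - ∫ x in S, (v : Jet S) (some j) x * ψ x} := by
    simp only [integral_mul_eq_inner _ (hψ.pderiv_memLp j _), integral_mul_eq_inner _ (hψ.memLp _)]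
    refine isClosed_eq ?_ ?_ <;> fun_prop
  -- The identity is a closed condition on `v`, so density reduces it to functions vanishing near
  -- the port.
  suffices h : (vanishNear S (frontier S ∩ Ω) : Set (H1 S)) ⊆ _ from
    fun v hv => closure_minimal h hcl hv
  rintro v ⟨ε, hε, hv⟩
  set Γ := frontier S ∩ Ω
  set T := Metric.thickening ε Γ
  have hTo : IsOpen T := Metric.isOpen_thickening
  have hg := H1.grad_ae_eq_zero (hTo.inter hS) inter_subset_right v (by
    filter_upwards [hv] with x hx hxT using hx hxT.1) j
  -- A boundary point of `S` in the support of `ψ` lies in `Ω`, hence in `Γ ⊆ T`; so `K` stays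
  -- inside `S`, and cutting off around `K` changes `ψ` only where `v` vanishes.
  set K := (tsupport ψ ∩ closure S) \ T
  have hKc : IsClosed K := ((isClosed_tsupport ψ).inter isClosed_closure).sdiff hTo
  have hKS : K ⊆ S := by
    rintro x ⟨⟨hx1, hx2⟩, hx3⟩
    by_contra hxS
    refine hx3 (Metric.self_subset_thickening hε _ ⟨⟨hx2, ?_⟩, hψ.2.2 hx1⟩)
    rwa [hS.interior_eq]
  obtain ⟨χ, hχ, hχS, hχ1⟩ := exists_smooth_cutoff hS hKc hKS
  have htest : IsTest S (fun x => χ x * ψ x) :=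
    ⟨hχ.mul hψ.1, hψ.2.1.mul_left,
      (closure_mono (Function.support_mul_subset_left _ _)).trans hχS⟩
  have h1 := v.2 j _ htest
  have hcase : ∀ x ∈ S, x ∈ T ∨ x ∉ tsupport ψ ∨ x ∈ K := fun x hx => by
    by_cases h1 : x ∈ T
    · exact Or.inl h1
    by_cases h2 : x ∈ tsupport ψ
    · exact Or.inr (Or.inr ⟨⟨h2, subset_closure hx⟩, h1⟩)
    · exact Or.inr (Or.inl h2)
  have hd : ∀ x, x ∉ tsupport ψ → pderiv j ψ x = 0 := fun x hx => by
    have : fderiv ℝ ψ x = 0 := by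
      by_contra hne
      exact hx (support_fderiv_subset ℝ hne)
    simp [pderiv, this]
  have hχd : ∀ x ∈ K, pderiv j χ x = 0 := fun x hx => by
    simp [pderiv, (hχ1 x hx).fderiv_eq]
  have e1 : ∫ x in S, (v : Jet S) none x * pderiv j (fun x => χ x * ψ x) x =
      ∫ x in S, (v : Jet S) none x * pderiv j ψ x := by
    refine integral_congr_ae ?_
    filter_upwards [hv, ae_restrict_mem hS.measurableSet] with x hx hxS
    rw [pderiv_mul hχ hψ.1]
    rcases hcase x hxS with h | h | h
    · have h0 : (v : Jet S) none x = 0 := hx h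
      simp [h0]
    · simp [hd x h, image_eq_zero_of_notMem_tsupport h]
    · simp [hχd x h, (hχ1 x h).eq_of_nhds]
  have e2 : ∫ x in S, (v : Jet S) (some j) x * (χ x * ψ x) =
      ∫ x in S, (v : Jet S) (some j) x * ψ x := by
    refine integral_congr_ae ?_
    filter_upwards [hg, ae_restrict_mem hS.measurableSet] with x hx hxS
    rcases hcase x hxS with h | h | h
    · simp [hx ⟨h, hxS⟩]
    · simp [image_eq_zero_of_notMem_tsupport h]
    · simp [(hχ1 x h).eq_of_nhds]
  rw [e1, e2] at h1
  exact h1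

/-- Functions with zero trace on `∂S ∩ Ω` extend by zero to functions in `H¹(Ω)`. -/
theorem exists_ext_of_zeroTrace {d : ℕ} {S Ω : Set (E d)} (hS : IsOpen S)
    (hSΩ : S ⊆ Ω) (v : H1 S) (hv : v ∈ zeroTrace S (frontier S ∩ Ω)) :
    ∃ w : H1 Ω, w.fn =ᵐ[volume.restrict Ω] S.indicator v.fn := by
  have hr : (volume.restrict Ω).restrict S = volume.restrict S :=
    Measure.restrict_restrict_of_subset hSΩ
  have m : ∀ k, MemLp (S.indicator ((v : Jet S) k)) 2 (volume.restrict Ω) := fun k => by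
    rw [memLp_indicator_iff_restrict hS.measurableSet, hr]
    exact Lp.memLp _
  have hi : ∀ (k : Option (Fin d)) (g : E d → ℝ), ∫ x in Ω, (m k).toLp _ x * g x =
      ∫ x in S, (v : Jet S) k x * g x := fun k g => by
    have h1 : ∫ x in S, (v : Jet S) k x * g x ∂(volume.restrict Ω) =
        ∫ x in S, (v : Jet S) k x * g x :=
      congrArg (fun μ => ∫ x, (v : Jet S) k x * g x ∂μ) hr
    rw [← h1, ← integral_indicator hS.measurableSet]
    refine integral_congr_ae ?_
    filter_upwards [(m k).coeFn_toLp] with x hx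
    rw [hx]
    by_cases hxS : x ∈ S <;> simp [hxS]
  refine ⟨⟨WithLp.toLp 2 fun k => (m k).toLp, fun j ψ hψ => ?_⟩, (m none).coeFn_toLp⟩
  change ∫ x in Ω, (m none).toLp _ x * pderiv j ψ x = - ∫ x in Ω, (m (some j)).toLp _ x * ψ x
  rw [hi, hi]
  exact integral_mul_pderiv_of_zeroTrace hS v hv j ψ hψ

/-! ### The trace space -/

theorem trace_eq_zero_iff {d : ℕ} {S Γ : Set (E d)} {v : H1 S} :
    trace S Γ v = 0 ↔ v ∈ zeroTrace S Γ := by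
  simp [trace]

/-- Makes `halfInner` definite: if `v` minus its projection onto the zero-trace functions is `0`,
then `v` is one of them. -/
theorem eq_zero_of_minLift_eq_zero {d : ℕ} {S Γ : Set (E d)} {l : HHalf S Γ}
    (h : minLift S Γ l = 0) : l = 0 := by
  obtain ⟨x, rfl⟩ := Submodule.mkQ_surjective _ l
  have h1 : x - (zeroTrace S Γ).starProjection x = 0 := h
  rw [sub_eq_zero] at h1
  exact trace_eq_zero_iff.2 (Submodule.starProjection_eq_self_iff.1 h1.symm)

theorem eq_rev_of_ne {k i : Fin 2} (h : k ≠ i) : k = i.rev := by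
  revert k i
  decide

theorem sum_eq_add_rev {M : Type*} [AddCommMonoid M] (g : Fin 2 → M) (i : Fin 2) :
    ∑ k, g k = g i + g i.rev := by
  rw [Fin.sum_univ_two]
  fin_cases i
  · rfl
  · exact add_comm _ _

section

variable {d : ℕ} {D : Decomp d} {X : Submodule ℝ (H1 D.Ω)}

theorem portInner_sub_left (w w' v : Port D X) :
    portInner (w - w') v = portInner w v - portInner w' v := by
  simp [portInner, halfInner, inner_sub_left, Finset.sum_sub_distrib]

theorem eq_zero_of_portInner_self {w : Port D X} (h : portInner w w = 0) : w = 0 := by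
  have h1 := (Finset.sum_eq_zero_iff_of_nonneg fun i _ => real_inner_self_nonneg).1 h
  funext i
  exact Subtype.ext (eq_zero_of_minLift_eq_zero
    (inner_self_eq_zero.1 (h1 i (Finset.mem_univ i))))

/-- The residual is itself an admissible test function, so definiteness forces it to vanish. -/
theorem solvesPort_iff {b : LocForms D X} {f : X →L[ℝ] ℝ} {lam : Port D X} :
    SolvesPort b f lam ↔ lam - portT b lam = portG b f := by
  constructor
  · intro h
    rw [← sub_eq_zero]
    refine eq_zero_of_portInner_self ?_
    rw [portInner_sub_left, sub_eq_zero]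
    exact h _
  · intro h v
    rw [aPort, h, fPort]

theorem locTrace_eq_iff {i : Fin 2} {u v : locSpace D X i} :
    locTrace D X i u = locTrace D X i v ↔
      ((u : H1 (D.sub i)) - v) ∈ zeroTrace (D.sub i) (D.port i) := by
  rw [← trace_eq_zero_iff, map_sub, sub_eq_zero, Subtype.ext_iff]
  rfl

theorem locTrace_add {i : Fin 2} (u v : locSpace D X i) :
    locTrace D X i (u + v) = locTrace D X i u + locTrace D X i v :=
  Subtype.ext (map_add (trace (D.sub i) (D.port i)) (u : H1 (D.sub i)) v)

theorem locRes_add (i : Fin 2) (u v : X) :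
    locRes D X i (u + v) = locRes D X i u + locRes D X i v :=
  Subtype.ext (map_add (res (D.subset i)) (u : H1 D.Ω) v)

theorem coe_locRes (i : Fin 2) (u : X) :
    (locRes D X i u : H1 (D.sub i)) = res (D.subset i) (u : H1 D.Ω) := rfl

theorem globTrace_eq_iff {i : Fin 2} {u v : X} :
    globTrace D X i u = globTrace D X i v ↔
      res (D.subset i) ((u - v : X) : H1 D.Ω) ∈ zeroTrace (D.sub i) (D.port i) := by
  rw [globTrace, globTrace, locTrace_eq_iff, coe_locRes, coe_locRes, ← map_sub]
  rfl

theorem globTrace_add (i : Fin 2) (u v : X) :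
    globTrace D X i (u + v) = globTrace D X i u + globTrace D X i v := by
  simp only [globTrace, locRes_add, locTrace_add]

/-! ### Consequences of the partition of unity -/

theorem ae_sub_of_ae {P : E d → Prop} (i : Fin 2) (h : ∀ᵐ x ∂(volume.restrict D.Ω), P x) :
    ∀ᵐ x ∂(volume.restrict (D.sub i)), P x :=
  ae_mono (Measure.restrict_mono (D.subset i) le_rfl) h

theorem ae_of_ae_sub {P : E d → Prop} (i : Fin 2)
    (h : ∀ᵐ x ∂(volume.restrict (D.sub i)), P x) :
    ∀ᵐ x ∂(volume.restrict D.Ω), x ∈ D.sub i → P x := by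
  rw [ae_restrict_iff' (D.isOpen_sub i).measurableSet] at h
  exact ae_restrict_of_ae h

theorem not_mem_sub_of_mem_port {i : Fin 2} {x : E d} (hx : x ∈ D.port i) : x ∉ D.sub i := by
  have := hx.1.2
  rwa [(D.isOpen_sub i).interior_eq] at this

theorem IsPoU.add_rev {φ : Fin 2 → E d → ℝ} (hφ : IsPoU D φ) (i : Fin 2) {x : E d}
    (hx : x ∈ D.Ω) : φ i x + φ i.rev x = 1 := by
  rw [← sum_eq_add_rev (fun k => φ k x) i, hφ.sum_eq_one x hx]

/-- A function that vanishes on the other subdomain has zero trace on `Γ_i`. -/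
theorem IsPoU.mem_zeroTrace_of_vanish {φ : Fin 2 → E d → ℝ} (hφ : IsPoU D φ) (i : Fin 2)
    (w : H1 D.Ω) (hw : ∀ᵐ x ∂(volume.restrict D.Ω), x ∈ D.sub i.rev → w.fn x = 0) :
    res (D.subset i) w ∈ zeroTrace (D.sub i) (D.port i) := by
  obtain ⟨K, hK⟩ := hφ.lipschitz i
  refine Submodule.le_topologicalClosure _ ⟨1 / (K + 1), by positivity, ?_⟩
  filter_upwards [res_fn (D.subset i) w, ae_sub_of_ae i hw,
    ae_restrict_mem (D.isOpen_sub i).measurableSet] with x h1 h2 hx hxΓ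
  rw [h1]
  refine h2 ?_
  -- Outside `Ω_{i'}` one has `φ_i x = 1`, while `φ_i y = 0` at the port point `y`; the Lipschitz
  -- bound then contradicts `dist x y < 1 / (K + 1)`.
  by_contra hxr
  have hxΩ := D.subset i hx
  obtain ⟨y, hy, hxy⟩ := Metric.mem_thickening_iff.1 hxΓ
  have h3 := hK.dist_le_mul x hxΩ y hy.2
  rw [hφ.eq_zero i y hy.2 (not_mem_sub_of_mem_port hy), Real.dist_eq, sub_zero] at h3
  have h4 := hφ.add_rev i hxΩ
  rw [hφ.eq_zero i.rev x hxΩ hxr, add_zero] at h4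
  rw [h4, abs_one] at h3
  have h5 : (K : ℝ) * dist x y ≤ K * (1 / (K + 1)) := by gcongr
  have h6 : (K : ℝ) * (1 / (K + 1)) < 1 := by
    rw [mul_one_div, div_lt_one (by positivity)]
    linarith
  linarith

/-- Two lifts of the same function on `Ω_{i'}` differ by a function vanishing there, which has zero
trace on `Γ_i`. -/
theorem IsPoU.chi_locRes {φ : Fin 2 → E d → ℝ} (hφ : IsPoU D φ) (i : Fin 2) (w : X) :
    chi D X i (locRes D X i.rev w) = globTrace D X i w := by
  have hc := (exists_glob D X (locRes D X i.rev w)).choose_spec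
  set w' := (exists_glob D X (locRes D X i.rev w)).choose
  have h0 : res (D.subset i.rev) ((w' - w : X) : H1 D.Ω) = 0 := by
    have := congrArg Subtype.val hc
    simp only [coe_locRes] at this
    rw [Submodule.coe_sub, map_sub, this, sub_self]
  refine globTrace_eq_iff.2 (hφ.mem_zeroTrace_of_vanish i _ (ae_of_ae_sub _ ?_))
  have h1 := res_fn (D.subset i.rev) ((w' - w : X) : H1 D.Ω)
  rw [h0] at h1
  filter_upwards [h1, Lp.coeFn_zero ℝ 2 (volume.restrict (D.sub i.rev))] with x h2 h3
  rw [← h2]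
  exact h3

theorem IsPoU.chi_add {φ : Fin 2 → E d → ℝ} (hφ : IsPoU D φ) (i : Fin 2)
    (u v : locSpace D X i.rev) : chi D X i (u + v) = chi D X i u + chi D X i v := by
  obtain ⟨u, rfl⟩ := exists_glob D X u
  obtain ⟨v, rfl⟩ := exists_glob D X v
  rw [← locRes_add, hφ.chi_locRes, hφ.chi_locRes, hφ.chi_locRes, globTrace_add]

/-! ### The functions in `X` supported in a subdomain -/

variable (D X) in
/-- The extensions by zero of the functions in `X_{i,0}`, as a subspace of `X`. -/
def extSpace (i : Fin 2) : Submodule ℝ X :=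
  (zeroTrace (D.sub i) (D.port i)).comap ((res (D.subset i)).comp X.subtype) ⊓
    LinearMap.ker ((resL2 (sdiff_subset (s := D.Ω) (t := D.sub i))).comp
      ((toL2 D.Ω).toLinearMap.comp X.subtype))

theorem isClosed_extSpace (i : Fin 2) : IsClosed (extSpace D X i : Set X) := by
  refine IsClosed.inter ?_ ?_
  · exact (isClosed_zeroTrace _ _).preimage ((continuous_res _).comp continuous_subtype_val)
  · exact isClosed_singleton.preimage
      ((continuous_resL2 (sdiff_subset (s := D.Ω) (t := D.sub i))).comp ((toL2 D.Ω).continuous.comp continuous_subtype_val))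

theorem mem_extSpace {i : Fin 2} {w : X} :
    w ∈ extSpace D X i ↔ res (D.subset i) (w : H1 D.Ω) ∈ zeroTrace (D.sub i) (D.port i) ∧
      ∀ᵐ x ∂(volume.restrict D.Ω), x ∉ D.sub i → (w : H1 D.Ω).fn x = 0 := by
  refine and_congr Iff.rfl ?_
  have hm : MeasurableSet (D.sub i) := (D.isOpen_sub i).measurableSet
  have hms : MeasurableSet (D.Ω \ D.sub i) := D.isOpen_Ω.measurableSet.diff hm
  have h1 := resL2_ae (sdiff_subset (s := D.Ω) (t := D.sub i)) (toL2 D.Ω (w : H1 D.Ω))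
  change resL2 (sdiff_subset (s := D.Ω) (t := D.sub i)) (toL2 D.Ω (w : H1 D.Ω)) = 0 ↔ _
  rw [Lp.eq_zero_iff_ae_eq_zero]
  have h2 : (∀ᵐ x ∂(volume.restrict D.Ω), x ∉ D.sub i → (w : H1 D.Ω).fn x = 0) ↔
      ∀ᵐ x ∂(volume.restrict (D.Ω \ D.sub i)), (w : H1 D.Ω).fn x = 0 := by
    rw [ae_restrict_iff' hms, ae_restrict_iff' D.isOpen_Ω.measurableSet]
    simp only [Set.mem_sdiff, and_imp]
  rw [h2]
  constructor <;> intro h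
  · filter_upwards [h, h1] with x hx hx1
    exact hx1.symm.trans hx
  · filter_upwards [h, h1] with x hx hx1
    exact hx1.trans hx

/-- With its converse `isExt_of_mem_extSpace`, this moves the local problems from `X_{i,0}` to a
closed subspace of `X`, where `a` is coercive. -/
theorem IsExt.mem_extSpace {i : Fin 2} {v : H1 (D.sub i)}
    (hv : v ∈ zeroTrace (D.sub i) (D.port i)) {w : X} (h : IsExt D i v w) :
    w ∈ extSpace D X i ∧ res (D.subset i) (w : H1 D.Ω) = v := by
  have h1 : res (D.subset i) (w : H1 D.Ω) = v := by
    refine H1.ext_fn (D.isOpen_sub i) ?_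
    filter_upwards [res_fn (D.subset i) (w : H1 D.Ω), ae_sub_of_ae i h,
      ae_restrict_mem (D.isOpen_sub i).measurableSet] with x h1 h2 h3
    rw [h1, h2, indicator_of_mem h3]
  refine ⟨Schwarz.mem_extSpace.2 ⟨h1 ▸ hv, ?_⟩, h1⟩
  filter_upwards [h] with x h2 h3
  rw [h2, indicator_of_notMem h3]

theorem isExt_of_mem_extSpace {i : Fin 2} {w : X} (h : w ∈ extSpace D X i) :
    IsExt D i (res (D.subset i) (w : H1 D.Ω)) w := by
  filter_upwards [(mem_extSpace.1 h).2,
    ae_of_ae_sub i (res_fn (D.subset i) (w : H1 D.Ω))] with x h1 h2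
  by_cases hx : x ∈ D.sub i
  · rw [indicator_of_mem hx, h2 hx]
  · rw [indicator_of_notMem hx, h1 hx]

theorem locRes_mem_bubble {i : Fin 2} {w : X} (h : w ∈ extSpace D X i) :
    (locRes D X i w : H1 (D.sub i)) ∈ bubble D X i :=
  ⟨(locRes D X i w).2, (mem_extSpace.1 h).1⟩

/-- The extension by zero of an element of `X_{i,0}` exists in `X`. -/
theorem exists_ext (hX_ext : ∀ (i : Fin 2), ∀ v ∈ bubble D X i, ∀ w : H1 D.Ω,
      IsExt D i v w → w ∈ X) (i : Fin 2) (v : bubble D X i) : ∃ w : X, IsExt D i v w := by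
  obtain ⟨w, hw⟩ := exists_ext_of_zeroTrace (D.isOpen_sub i) (D.subset i) _ v.2.2
  exact ⟨⟨w, hX_ext i v v.2 w hw⟩, hw⟩

/-- A Lipschitz partition of unity splits `X` into the functions supported in the subdomains. -/
theorem IsPoU.exists_mul {φ : Fin 2 → E d → ℝ} (hφ : IsPoU D φ)
    (hX_mul : ∀ (i : Fin 2), ∀ v ∈ X, ∀ w : H1 D.Ω,
      w.fn =ᵐ[volume.restrict D.Ω] (fun x => φ i x * v.fn x) → w ∈ X) (i : Fin 2) (v : X) :
    ∃ w ∈ extSpace D X i,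
      (w : H1 D.Ω).fn =ᵐ[volume.restrict D.Ω] fun x => φ i x * (v : H1 D.Ω).fn x := by
  obtain ⟨K, hK⟩ := hφ.lipschitz i
  -- `φ_i` is Lipschitz only on `Ω`; mollification needs a function on all of `ℝ^d`.
  obtain ⟨η, hη, hηφ⟩ := hK.extend_real
  have hM : ∀ x ∈ D.Ω, |η x| ≤ 1 := fun x hx => by
    rw [← hηφ hx, abs_of_nonneg (hφ.nonneg i x hx)]
    exact hφ.le_one i x hx
  obtain ⟨w, hw, -⟩ := exists_lipschitz_mul D.isOpen_Ω hη zero_le_one hM (v : H1 D.Ω)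
  have hw' : w.fn =ᵐ[volume.restrict D.Ω] fun x => φ i x * (v : H1 D.Ω).fn x := by
    filter_upwards [hw, ae_restrict_mem D.isOpen_Ω.measurableSet] with x h1 hx
    rw [h1, hηφ hx]
  refine ⟨⟨w, hX_mul i v v.2 w hw'⟩, mem_extSpace.2 ⟨?_, ?_⟩, hw'⟩
  · refine mem_zeroTrace_of_lipschitz_mul (D.isOpen_sub i) hη (M := 1)
      (fun x hx => hM x (D.subset i hx))
      (fun x hx => hηφ (D.subset i hx) ▸ hφ.nonneg i x (D.subset i hx))
      (fun x (hx : x ∈ D.port i) => hηφ hx.2 ▸ hφ.eq_zero i x hx.2 (not_mem_sub_of_mem_port hx))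
      (res (D.subset i) (v : H1 D.Ω)) _ ?_
    filter_upwards [res_fn (D.subset i) w, res_fn (D.subset i) (v : H1 D.Ω),
      ae_sub_of_ae i hw] with x h1 h2 h3
    rw [h1, h2, h3]
  · filter_upwards [hw', ae_restrict_mem D.isOpen_Ω.measurableSet] with x h1 hxΩ hx
    exact h1.trans (by rw [hφ.eq_zero i x hxΩ hx, zero_mul])

/-! ### Local problems -/

theorem form_eq_local {a : X →ₗ[ℝ] X →ₗ[ℝ] ℝ} {b : LocForms D X}
    (hb : ∀ (i : Fin 2) (u : X) (v : bubble D X i) (w : X), IsExt D i v w →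
      a u w = b i (locRes D X i u) v) {i : Fin 2} {w : X} (hw : w ∈ extSpace D X i) (u : X) :
    a u w = b i (locRes D X i u) ⟨locRes D X i w, locRes_mem_bubble hw⟩ :=
  hb i u _ w (isExt_of_mem_extSpace hw)

/-- The form in which locality is used for gluing: against functions supported in `Ω_i`, only the
restriction of `u` to `Ω_i` counts. -/
theorem form_congr_of_locRes_eq {a : X →ₗ[ℝ] X →ₗ[ℝ] ℝ} {b : LocForms D X}
    (hb : ∀ (i : Fin 2) (u : X) (v : bubble D X i) (w : X), IsExt D i v w →
      a u w = b i (locRes D X i u) v) {i : Fin 2} {w : X} (hw : w ∈ extSpace D X i) {u u' : X}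
    (h : res (D.subset i) (u : H1 D.Ω) = res (D.subset i) (u' : H1 D.Ω)) : a u w = a u' w := by
  have : locRes D X i u = locRes D X i u' := Subtype.ext h
  rw [form_eq_local hb hw, form_eq_local hb hw, this]

theorem eq_zero_of_form_self {a : X →ₗ[ℝ] X →ₗ[ℝ] ℝ} {α : ℝ} (hα : 0 < α)
    (ha_coer : ∀ v : X, α * ‖v‖ ^ 2 ≤ a v v) {v : X} (h : a v v = 0) : v = 0 := by
  have h1 := ha_coer v
  rw [h] at h1
  have h2 : ‖v‖ ^ 2 ≤ 0 := nonpos_of_mul_nonpos_right h1 hα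
  exact norm_eq_zero.1 (pow_eq_zero_iff two_ne_zero |>.1 (le_antisymm h2 (sq_nonneg _)))

/-- `u` solves the local problem on `Ω_i` with trace `lam` and right-hand side `g`. -/
def IsLocalSolution (b : LocForms D X) (g : X →L[ℝ] ℝ) (i : Fin 2) (lam : portSpace D X i)
    (u : locSpace D X i) : Prop :=
  locTrace D X i u = lam ∧ ∀ (v : bubble D X i) (w : X), IsExt D i v w → b i u v = g w

/-- Treats `T_i` and `G_i` through one local problem. Existence of zero extensions keeps the
condition on `w` from being vacuous. -/
theorem isT_iff (hX_ext : ∀ (i : Fin 2), ∀ v ∈ bubble D X i, ∀ w : H1 D.Ω,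
      IsExt D i v w → w ∈ X) {b : LocForms D X} {i : Fin 2} {lam : portSpace D X i}
    {u : locSpace D X i} : IsT b i lam u ↔ IsLocalSolution b 0 i lam u := by
  refine and_congr Iff.rfl ⟨fun h v w _ => h v, fun h v => ?_⟩
  obtain ⟨w, hw⟩ := exists_ext hX_ext i v
  exact h v w hw

/-- The difference of two solutions lies in `X_{i,0}`; its zero extension `w` satisfies `a(w,w) =
0`, so coercivity on `X` applies. -/
theorem IsLocalSolution.unique (hX_ext : ∀ (i : Fin 2), ∀ v ∈ bubble D X i, ∀ w : H1 D.Ω,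
      IsExt D i v w → w ∈ X)
    {a : X →ₗ[ℝ] X →ₗ[ℝ] ℝ} {α : ℝ} (hα : 0 < α) (ha_coer : ∀ v : X, α * ‖v‖ ^ 2 ≤ a v v)
    {b : LocForms D X}
    (hb : ∀ (i : Fin 2) (u : X) (v : bubble D X i) (w : X), IsExt D i v w →
      a u w = b i (locRes D X i u) v) {g : X →L[ℝ] ℝ} {i : Fin 2} {lam : portSpace D X i}
    {u u' : locSpace D X i} (hu : IsLocalSolution b g i lam u)
    (hu' : IsLocalSolution b g i lam u') : u = u' := by
  have h1 := locTrace_eq_iff.1 (hu.1.trans hu'.1.symm)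
  let z : bubble D X i := ⟨(u - u' : locSpace D X i), (u - u').2, h1⟩
  obtain ⟨w, hw⟩ := exists_ext hX_ext i z
  have hres := (hw.mem_extSpace z.2.2).2
  have hr : locRes D X i w = u - u' := Subtype.ext hres
  have h2 : a w w = 0 := by
    rw [hb i w z w hw, hr, map_sub, LinearMap.sub_apply, hu.2 z w hw, hu'.2 z w hw, sub_self]
  have h3 := eq_zero_of_form_self hα ha_coer h2
  rw [← sub_eq_zero, ← hr, h3]
  exact Subtype.ext (map_zero (res (D.subset i)))

/-- Lift the trace to `w₀ ∈ X` and correct it by Lax-Milgram in `extSpace`, which leaves the trace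
on `Γ_i` unchanged. -/
theorem existsUnique_localSolution (hX_closed : IsClosed (X : Set (H1 D.Ω)))
    (hX_ext : ∀ (i : Fin 2), ∀ v ∈ bubble D X i, ∀ w : H1 D.Ω, IsExt D i v w → w ∈ X)
    {a : X →ₗ[ℝ] X →ₗ[ℝ] ℝ} {γ α : ℝ} (hα : 0 < α)
    (ha_cont : ∀ u v : X, |a u v| ≤ γ * ‖u‖ * ‖v‖) (ha_coer : ∀ v : X, α * ‖v‖ ^ 2 ≤ a v v)
    {b : LocForms D X}
    (hb : ∀ (i : Fin 2) (u : X) (v : bubble D X i) (w : X), IsExt D i v w →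
      a u w = b i (locRes D X i u) v) (g : X →L[ℝ] ℝ) (i : Fin 2) (lam : portSpace D X i) :
    ∃! u, IsLocalSolution b g i lam u := by
  have : CompleteSpace X := hX_closed.completeSpace_coe
  obtain ⟨u₀, hu₀, hlam⟩ := lam.2
  obtain ⟨w₀, hw₀⟩ := exists_glob D X ⟨u₀, hu₀⟩
  obtain ⟨z, hz, hzv⟩ := exists_solution_of_coercive a hα ha_cont ha_coer (extSpace D X i)
    (isClosed_extSpace i) g w₀
  refine existsUnique_of_exists_of_unique ⟨locRes D X i (w₀ + z), ?_, fun v w hw => ?_⟩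
    fun u u' hu hu' => hu.unique hX_ext hα ha_coer hb hu'
  · have h1 : globTrace D X i (w₀ + z) = globTrace D X i w₀ :=
      globTrace_eq_iff.2 (by rw [add_sub_cancel_left]; exact (mem_extSpace.1 hz).1)
    refine h1.trans (Subtype.ext ?_)
    rw [globTrace, hw₀]
    exact hlam
  · rw [← hb i _ v w hw]
    exact hzv w (hw.mem_extSpace v.2.2).1

/-! ### Gluing local solutions -/

/-- A function in `X` with zero trace on both ports that is `a`-orthogonal to the functions
supported in the overlap vanishes there. -/
theorem IsPoU.ae_eq_zero_overlap {φ : Fin 2 → E d → ℝ} (hφ : IsPoU D φ)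
    (hX_ext : ∀ (i : Fin 2), ∀ v ∈ bubble D X i, ∀ w : H1 D.Ω, IsExt D i v w → w ∈ X)
    {a : X →ₗ[ℝ] X →ₗ[ℝ] ℝ} {α : ℝ} (hα : 0 < α) (ha_coer : ∀ v : X, α * ‖v‖ ^ 2 ≤ a v v)
    {b : LocForms D X}
    (hb : ∀ (i : Fin 2) (u : X) (v : bubble D X i) (w : X), IsExt D i v w →
      a u w = b i (locRes D X i u) v) (z : X)
    (hz : ∀ i, res (D.subset i) (z : H1 D.Ω) ∈ zeroTrace (D.sub i) (D.port i))
    (hza : ∀ v, (∀ i, v ∈ extSpace D X i) → a z v = 0) :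
    ∀ᵐ x ∂(volume.restrict D.Ω), (∀ i, x ∈ D.sub i) → (z : H1 D.Ω).fn x = 0 := by
  choose y hy using fun i => exists_ext hX_ext i
    ⟨res (D.subset i) (z : H1 D.Ω), Submodule.mem_map_of_mem z.2, hz i⟩
  have hyr : ∀ i, res (D.subset i) (y i : H1 D.Ω) = res (D.subset i) (z : H1 D.Ω) :=
    fun i => ((hy i).mem_extSpace (hz i)).2
  have hyin : ∀ i, ∀ᵐ x ∂(volume.restrict D.Ω), x ∈ D.sub i →
      (y i : H1 D.Ω).fn x = (z : H1 D.Ω).fn x := fun i => by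
    filter_upwards [hy i, ae_of_ae_sub i (res_fn (D.subset i) (z : H1 D.Ω))] with x h1 h2 hx
    rw [h1, indicator_of_mem hx, h2 hx]
  have hyout : ∀ i, ∀ᵐ x ∂(volume.restrict D.Ω), x ∉ D.sub i →
      (y i : H1 D.Ω).fn x = 0 := fun i =>
    (mem_extSpace.1 ((hy i).mem_extSpace (hz i)).1).2
  -- On `Ω_i` outside the other subdomain `t = z + 0 - z = 0`, and on the overlap `t = z + z - z =
  -- z`.
  set t : X := ∑ i, y i - z with ht
  have hti : ∀ i, t = y i + (y i.rev - z) := fun i => by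
    rw [ht, sum_eq_add_rev y i, add_sub_assoc]
  have htfn : ∀ i, (t : H1 D.Ω).fn =ᵐ[volume.restrict D.Ω] fun x =>
      (y i : H1 D.Ω).fn x + ((y i.rev : H1 D.Ω).fn x - (z : H1 D.Ω).fn x) := fun i => by
    rw [hti i]
    filter_upwards [H1.fn_add (y i : H1 D.Ω) ((y i.rev - z : X) : H1 D.Ω),
      H1.fn_sub (y i.rev : H1 D.Ω) (z : H1 D.Ω)] with x h1 h2
    exact h1.trans (congrArg _ h2)
  have htmem : ∀ i, t ∈ extSpace D X i := fun i => by
    refine mem_extSpace.2 ⟨?_, ?_⟩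
    -- On `Ω_i`, `t` is `z` plus `y_{i'} - z`; the latter vanishes on `Ω_{i'}`, so both have zero
    -- trace on `Γ_i`.
    · rw [hti i, Submodule.coe_add, map_add, hyr i]
      refine Submodule.add_mem _ (hz i) (hφ.mem_zeroTrace_of_vanish i _ ?_)
      filter_upwards [hyin i.rev, H1.fn_sub (y i.rev : H1 D.Ω) (z : H1 D.Ω)] with x h1 h2 hx
      refine h2.trans ?_
      rw [h1 hx, sub_self]
    · filter_upwards [htfn i, hyout i, hyin i.rev, ae_restrict_mem D.isOpen_Ω.measurableSet]
        with x h1 h2 h3 hxΩ hx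
      have hxr : x ∈ D.sub i.rev := by
        by_contra hxr
        have := hφ.add_rev i hxΩ
        rw [hφ.eq_zero i x hxΩ hx, hφ.eq_zero i.rev x hxΩ hxr] at this
        norm_num at this
      rw [h1, h2 hx, h3 hxr, sub_self, add_zero]
  have hat : a t t = 0 := by
    have h1 : ∀ i, a (y i) t = 0 := fun i => by
      rw [form_congr_of_locRes_eq hb (htmem i) (hyr i), hza t htmem]
    have h2 : a t = ∑ i, a (y i) - a z := by rw [ht, map_sub, map_sum]
    rw [h2, LinearMap.sub_apply, LinearMap.sum_apply, hza t htmem,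
      Finset.sum_eq_zero fun i _ => h1 i, sub_zero]
  have ht0 := eq_zero_of_form_self hα ha_coer hat
  have h0 := htfn 0
  rw [ht0] at h0
  filter_upwards [h0, hyin 0, hyin (Fin.rev 0), Lp.coeFn_zero ℝ 2 (volume.restrict D.Ω)]
    with x h1 h2 h3 h4 hx
  rw [h2 (hx _), h3 (hx _), sub_self, add_zero] at h1
  rw [← h1]
  exact h4

/-- If the functions `w_i` solve the problem in the subdomains and have the same traces on the
ports, then `∑ φ_i w_i` solves the global problem. -/
theorem IsPoU.exists_solvesGlobal {φ : Fin 2 → E d → ℝ} (hφ : IsPoU D φ)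
    (hX_ext : ∀ (i : Fin 2), ∀ v ∈ bubble D X i, ∀ w : H1 D.Ω, IsExt D i v w → w ∈ X)
    (hX_mul : ∀ (i : Fin 2), ∀ v ∈ X, ∀ w : H1 D.Ω,
      w.fn =ᵐ[volume.restrict D.Ω] (fun x => φ i x * v.fn x) → w ∈ X)
    {a : X →ₗ[ℝ] X →ₗ[ℝ] ℝ} {α : ℝ} (hα : 0 < α) (ha_coer : ∀ v : X, α * ‖v‖ ^ 2 ≤ a v v)
    {f : X →L[ℝ] ℝ} {b : LocForms D X}
    (hb : ∀ (i : Fin 2) (u : X) (v : bubble D X i) (w : X), IsExt D i v w →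
      a u w = b i (locRes D X i u) v) (w : Fin 2 → X)
    (hw : ∀ i, globTrace D X i (w i.rev) = globTrace D X i (w i))
    (hwa : ∀ i, ∀ v ∈ extSpace D X i, a (w i) v = f v) :
    ∃ u : X, (u : H1 D.Ω).fn =ᵐ[volume.restrict D.Ω]
      (fun x => ∑ i, φ i x * (w i : H1 D.Ω).fn x) ∧ SolvesGlobal a f u := by
  have hdiff : ∀ i, ∀ᵐ x ∂(volume.restrict D.Ω), (∀ k, x ∈ D.sub k) →
      (w i.rev : H1 D.Ω).fn x = (w i : H1 D.Ω).fn x := fun i => by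
    have h1 : res (D.subset i) ((w i.rev - w i : X) : H1 D.Ω) ∈
        zeroTrace (D.sub i) (D.port i) := globTrace_eq_iff.1 (hw i)
    have h2 : res (D.subset i.rev) ((w i.rev - w i : X) : H1 D.Ω) ∈
        zeroTrace (D.sub i.rev) (D.port i.rev) := by
      have := globTrace_eq_iff.1 (hw i.rev).symm
      rwa [Fin.rev_rev] at this
    have h3 := hφ.ae_eq_zero_overlap hX_ext hα ha_coer hb (w i.rev - w i)
      (fun k => by
        rcases eq_or_ne k i with rfl | hk
        · exact h1
        · rw [eq_rev_of_ne hk]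
          exact h2)
      (fun v hv => by
        rw [map_sub, LinearMap.sub_apply, hwa _ v (hv _), hwa _ v (hv _), sub_self])
    filter_upwards [h3, H1.fn_sub (w i.rev : H1 D.Ω) (w i : H1 D.Ω)] with x h4 h5 hx
    have h6 := h4 hx
    rw [Submodule.coe_sub, h5] at h6
    linarith
  choose p hp hpfn using fun i => hφ.exists_mul hX_mul i (w i)
  have hsum : ∀ q : Fin 2 → X, ((∑ i, q i : X) : H1 D.Ω).fn =ᵐ[volume.restrict D.Ω]
      fun x => ∑ i, (q i : H1 D.Ω).fn x := fun q => by
    filter_upwards [H1.fn_add (q 0 : H1 D.Ω) (q 1 : H1 D.Ω)] with x hx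
    rw [Fin.sum_univ_two, Fin.sum_univ_two]
    exact hx
  have hufn : ((∑ i, p i : X) : H1 D.Ω).fn =ᵐ[volume.restrict D.Ω]
      fun x => ∑ i, φ i x * (w i : H1 D.Ω).fn x := by
    filter_upwards [hsum p, hpfn 0, hpfn 1] with x h1 h2 h3
    rw [h1, Fin.sum_univ_two, Fin.sum_univ_two, h2, h3]
  refine ⟨∑ i, p i, hufn, fun v => ?_⟩
  -- On the overlap `w_1 = w_2` and the weights add up to one; on the rest of `Ω_i` the weight `φ_i`
  -- is one.
  have hres : ∀ i, res (D.subset i) ((∑ k, p k : X) : H1 D.Ω) =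
      res (D.subset i) (w i : H1 D.Ω) := fun i => by
    refine H1.ext_fn (D.isOpen_sub i) ?_
    filter_upwards [res_fn (D.subset i) ((∑ k, p k : X) : H1 D.Ω),
      res_fn (D.subset i) (w i : H1 D.Ω), ae_sub_of_ae i hufn, ae_sub_of_ae i (hdiff i),
      ae_restrict_mem (D.isOpen_sub i).measurableSet] with x h1 h2 h3 h4 hx
    have hxΩ := D.subset i hx
    have h5 := hφ.add_rev i hxΩ
    rw [h1, h2, h3, sum_eq_add_rev _ i]
    by_cases hxr : x ∈ D.sub i.rev
    · rw [h4 (fun k => by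
        rcases eq_or_ne k i with rfl | hk
        · exact hx
        · rw [eq_rev_of_ne hk]
          exact hxr), ← add_mul, h5, one_mul]
    · rw [hφ.eq_zero i.rev x hxΩ hxr] at h5 ⊢
      rw [add_zero] at h5
      rw [h5, zero_mul, add_zero, one_mul]
  choose q hq hqfn using fun i => hφ.exists_mul hX_mul i v
  have hv : v = ∑ i, q i := by
    refine Subtype.ext (H1.ext_fn D.isOpen_Ω ?_)
    filter_upwards [hsum q, hqfn 0, hqfn 1, ae_restrict_mem D.isOpen_Ω.measurableSet]
      with x h1 h2 h3 hx
    have h4 := hφ.sum_eq_one x hx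
    rw [Fin.sum_univ_two] at h4
    rw [h1, Fin.sum_univ_two, h2, h3, ← add_mul, h4, one_mul]
  rw [hv, map_sum (a (∑ i, p i)), map_sum f]
  refine Finset.sum_congr rfl fun i _ => ?_
  rw [form_congr_of_locRes_eq hb (hq i) (hres i), hwa i _ (hq i)]

end

end Schwarz

end

/-! ### Equivalence of the global and the port problem -/

theorem mainTheorem1 {d : ℕ} (D : Schwarz.Decomp d)
    (φ : Fin 2 → Schwarz.E d → ℝ) (hφ : Schwarz.IsPoU D φ)
    -- the ambient space `H¹₀(Ω) ⊆ X ⊆ H¹(Ω)`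
    (X : Submodule ℝ (Schwarz.H1 D.Ω)) (hX_closed : IsClosed (X : Set (Schwarz.H1 D.Ω)))
    (hX_H10 : Schwarz.H10 D.Ω ≤ X)
    -- the trivial extension of `v ∈ X_{i,0}`, as a function in `H¹(Ω)`, belongs to `X`
    (hX_ext : ∀ (i : Fin 2), ∀ v ∈ Schwarz.bubble D X i, ∀ w : Schwarz.H1 D.Ω,
      Schwarz.IsExt D i v w → w ∈ X)
    -- `φ_i v`, as a function in `H¹(Ω)`, belongs to `X` for `v ∈ X`
    (hX_mul : ∀ (i : Fin 2), ∀ v ∈ X, ∀ w : Schwarz.H1 D.Ω,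
      w.fn =ᵐ[volume.restrict D.Ω] (fun x => φ i x * v.fn x) → w ∈ X)
    -- the continuous coercive form, the functional, and the local forms
    (a : X →ₗ[ℝ] X →ₗ[ℝ] ℝ) (γ α : ℝ) (hα : 0 < α)
    (ha_cont : ∀ u v : X, |a u v| ≤ γ * ‖u‖ * ‖v‖)
    (ha_coer : ∀ v : X, α * ‖v‖ ^ 2 ≤ a v v)
    (f : X →L[ℝ] ℝ)
    (b : Schwarz.LocForms D X)
    (hb : ∀ (i : Fin 2) (u : X) (v : Schwarz.bubble D X i) (w : X), Schwarz.IsExt D i v w →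
      a u w = b i (Schwarz.locRes D X i u) v) :
    -- the objects in the port problem are well defined
    (∀ (i : Fin 2) (v : Schwarz.bubble D X i), ∃! w : X, Schwarz.IsExt D i v w) ∧
    (∀ (i : Fin 2) (lam : Schwarz.portSpace D X i), ∃! u, Schwarz.IsT b i lam u) ∧
    (∀ i : Fin 2, ∃! u, Schwarz.IsG b f i u) ∧
    (∀ (i : Fin 2) (w : X),
      Schwarz.chi D X i (Schwarz.locRes D X i.rev w) = Schwarz.globTrace D X i w) ∧
    -- from the global problem to the port problem
    (∀ u : X, Schwarz.SolvesGlobal a f u →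
      Schwarz.SolvesPort b f (fun i => Schwarz.globTrace D X i u)) ∧
    -- from the port problem to the global problem
    (∀ lam : Schwarz.Port D X, Schwarz.SolvesPort b f lam →
      ∃ u : X,
        (Schwarz.H1.fn (u : Schwarz.H1 D.Ω) =ᵐ[volume.restrict D.Ω] fun x =>
          ∑ i, Schwarz.H1.fn
            ((Schwarz.opT b i (lam i) + Schwarz.opG b i f : Schwarz.locSpace D X i) :
              Schwarz.H1 (D.sub i)) x * φ i x) ∧
        Schwarz.SolvesGlobal a f u) := by
  have hT : ∀ i lam, ∃! u, Schwarz.IsT b i lam u := fun i lam => by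
    simp only [Schwarz.isT_iff hX_ext]
    exact Schwarz.existsUnique_localSolution hX_closed hX_ext hα ha_cont ha_coer hb 0 i lam
  have hG : ∀ i, ∃! u, Schwarz.IsG b f i u := fun i =>
    Schwarz.existsUnique_localSolution hX_closed hX_ext hα ha_cont ha_coer hb f i 0
  have hopT : ∀ i lam, Schwarz.IsT b i lam (Schwarz.opT b i lam) := fun i lam => by
    rw [Schwarz.opT, dif_pos (hT i lam).exists]
    exact (hT i lam).exists.choose_spec
  have hopG : ∀ i, Schwarz.IsG b f i (Schwarz.opG b i f) := fun i => by
    rw [Schwarz.opG, dif_pos (hG i).exists]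
    exact (hG i).exists.choose_spec
  have hTG : ∀ i lam, Schwarz.IsLocalSolution b f i lam
      (Schwarz.opT b i lam + Schwarz.opG b i f) := fun i lam => by
    refine ⟨?_, fun v w hw => ?_⟩
    · rw [Schwarz.locTrace_add, (hopT i lam).1, (hopG i).1, add_zero]
    · rw [map_add, LinearMap.add_apply, (hopT i lam).2 v, (hopG i).2 v w hw, zero_add]
  -- The port problem as a matching condition: `λ_i` is the trace on `Γ_i` of the local solution on
  -- the other subdomain.
  have hport : ∀ lam : Schwarz.Port D X, Schwarz.SolvesPort b f lam ↔ ∀ i, lam i =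
      Schwarz.chi D X i (Schwarz.opT b i.rev (lam i.rev) + Schwarz.opG b i.rev f) :=
    fun lam => by
      rw [Schwarz.solvesPort_iff, funext_iff]
      refine forall_congr' fun i => ?_
      rw [hφ.chi_add]
      exact sub_eq_iff_eq_add'
  refine ⟨fun i v => ?_, hT, hG, hφ.chi_locRes, fun u hu => ?_, fun lam hlam => ?_⟩
  · obtain ⟨w, hw⟩ := Schwarz.exists_ext hX_ext i v
    exact ⟨w, hw, fun w' hw' =>
      Subtype.ext (Schwarz.H1.ext_fn D.isOpen_Ω (hw'.trans hw.symm))⟩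
  · have hloc : ∀ i, Schwarz.opT b i (Schwarz.globTrace D X i u) + Schwarz.opG b i f =
        Schwarz.locRes D X i u := fun i =>
      (hTG i _).unique hX_ext hα ha_coer hb
        ⟨rfl, fun v w hw => by rw [← hb i u v w hw, hu w]⟩
    refine (hport _).2 fun i => ?_
    rw [hloc, hφ.chi_locRes]
  · choose w hw using fun i => Schwarz.exists_glob D X
      (Schwarz.opT b i (lam i) + Schwarz.opG b i f)
    have hlam' := (hport lam).1 hlam
    obtain ⟨u, hu, hglob⟩ := hφ.exists_solvesGlobal hX_ext hX_mul hα ha_coer (f := f) hb w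
      (fun i => by
        rw [← hφ.chi_locRes, hw i.rev, ← hlam' i, Schwarz.globTrace, hw i]
        exact (hTG i (lam i)).1.symm)
      (fun i v hv => by
        rw [Schwarz.form_eq_local hb hv, hw i]
        exact (hTG i (lam i)).2 _ v (Schwarz.isExt_of_mem_extSpace hv))
    refine ⟨u, ?_, hglob⟩
    -- Outside `Ω_i` the representative of the local solution is meaningless, but `φ_i = 0` removes
    -- it.
    have hterm : ∀ i, ∀ᵐ x ∂(volume.restrict D.Ω), φ i x * Schwarz.H1.fn (w i : Schwarz.H1 D.Ω) x =
        Schwarz.H1.fn ((Schwarz.opT b i (lam i) + Schwarz.opG b i f : Schwarz.locSpace D X i) :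
          Schwarz.H1 (D.sub i)) x * φ i x := fun i => by
      have h1 := Schwarz.ae_of_ae_sub i (Schwarz.res_fn (D.subset i) (w i : Schwarz.H1 D.Ω))
      rw [← Schwarz.coe_locRes, hw i] at h1
      filter_upwards [h1, ae_restrict_mem D.isOpen_Ω.measurableSet] with x h2 hxΩ
      by_cases hx : x ∈ D.sub i
      · rw [h2 hx, mul_comm]
      · rw [hφ.eq_zero i x hxΩ hx, zero_mul, mul_zero]
    filter_upwards [hu, ae_all_iff.2 hterm] with x h1 h2
    rw [h1]
    exact Finset.sum_congr rfl fun i _ => h2 i
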